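/- Throughout, $\log$ is the natural logarithm. A $(p:q)$-coloring of a graph assigns to every vertex a $q$-element subset of $\{1,\dots,p\}$ such that adjacent vertices receive disjoint sets. In the deterministic LOCAL model with parameter $c\ge 1$, the vertices of an $n$-vertex graph carry arbitrary distinct integer identifiers between $1$ and $n^c$. After $t$ rounds, a vertex $v$ knows $n$, its own identifier and the subgraph induced by the set of vertices at distance at most $t$ from $v$, in which every vertex is labelled by its identifier, and nothing else. An algorithm runs for a number $T(n)$ of rounds (its round complexity), after which every vertex chooses its output as an arbitrary function of what it knows. It is said to compute a $(p:q)$-coloring of $n$-vertex trees if its outputs form a $(p:q)$-coloring for every $n$-vertex tree and every assignment of identifiers. (Upper bound.) For every $c\ge 1$ there is a constant $C>0$, depending only on $c$, such that for every integer $q\ge 1$ there is a deterministic LOCAL algorithm that computes a $(2q+1:q)$-coloring of $n$-vertex trees, for all $n\ge 1$, with round complexity at most $C\,(q\log n+q^2)$. (Lower bound.) For every fixed $q\ge 1$ this is best possible as a function of $n$: there are $\delta>0$ and $N$, depending only on $q$, such that for every $c\ge 1$ and every $n\ge N$, every deterministic LOCAL algorithm that computes a $(2q+1:q)$-coloring of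 $n$-vertex trees has round complexity at least $\delta\log n$ on $n$-vertex trees. -/

import Mathlib

/-- What a vertex knows about a network: its own identifier, and a finite graph whose vertices
are named by their identifiers. -/
structure LocalView where
  /-- the identifier of the observing vertex -/
  root : ℕ
  /-- the identifiers of the vertices it sees -/
  verts : Set ℕ
  /-- the pairs of identifiers that it sees to be joined by an edge -/
  Adj : ℕ → ℕ → Prop

/-- The labelled subgraph of `G` induced by the ball `B_t(v)` of all vertices at distance at most
`t` from `v`, together with the identity of its centre. The vertices are represented by their
identifiers only, so nothing else about them is visible. -/
def SimpleGraph.localView {V : Type*} (G : SimpleGraph V) (ident : V → ℕ) (t : ℕ) (v : V) :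
    LocalView where
  root := ident v
  verts := ident '' {w | G.edist v w ≤ (t : ℕ∞)}
  Adj a b := ∃ u w : V, G.edist v u ≤ (t : ℕ∞) ∧ G.edist v w ≤ (t : ℕ∞) ∧ G.Adj u w ∧
    ident u = a ∧ ident w = b

/-- A deterministic algorithm in the `LOCAL` model with outputs in `O`: on `n`-vertex graphs it
runs for a fixed number `rounds n` of rounds, after which every vertex chooses its output as a
function of what it knows by then. Local computation is unbounded. -/
structure LocalAlgorithm (O : Type*) where
  /-- the round complexity -/
  rounds : ℕ → ℕ
  /-- the output of a vertex, as a function of `n` and of the knowledge of the vertex -/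
  output : ℕ → LocalView → O

/-- The output of the vertex `v` when the algorithm is run on the `n`-vertex graph `G` with
identifiers `ident`. -/
def LocalAlgorithm.run {O : Type*} (A : LocalAlgorithm O) {n : ℕ} (G : SimpleGraph (Fin n))
    (ident : Fin n → ℕ) (v : Fin n) : O :=
  A.output n (G.localView ident (A.rounds n) v)

/-- The identifiers are distinct integers between `1` and `n ^ c`. -/
def IsIdentifierAssignment {n : ℕ} (c : ℝ) (ident : Fin n → ℕ) : Prop :=
  Function.Injective ident ∧ ∀ v, 1 ≤ ident v ∧ (ident v : ℝ) ≤ (n : ℝ) ^ c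

/-- A `(p : q)`-coloring: every vertex receives a `q`-element subset of a fixed set of `p` colors,
and adjacent vertices receive disjoint sets. -/
def SimpleGraph.IsPQColoring {V : Type*} (G : SimpleGraph V) (p q : ℕ)
    (f : V → Finset (Fin p)) : Prop :=
  (∀ v, (f v).card = q) ∧ ∀ ⦃u v⦄, G.Adj u v → Disjoint (f u) (f v)

/-- The algorithm computes a `(p : q)`-coloring of every `n`-vertex tree, whatever the assignment
of identifiers between `1` and `n ^ c`. -/
def LocalAlgorithm.ColorsTrees {p : ℕ} (A : LocalAlgorithm (Finset (Fin p))) (q : ℕ) (c : ℝ)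
    (n : ℕ) : Prop :=
  ∀ (G : SimpleGraph (Fin n)) (ident : Fin n → ℕ), G.IsTree → IsIdentifierAssignment c ident →
    G.IsPQColoring p q (A.run G ident)

/-!
# Distributed `(2q+1 : q)`-coloring of trees

**Upper bound.** The odd graph `K(2q+1, q)` contains a cycle of length `2q+1`, formed by cyclic
intervals of colors, so it is enough to map the tree homomorphically to this cycle. Suppose that a
set `B` of vertices, the *breakers*, is given such that distinct breakers are at distance more than
`2q` and every path that avoids `B` has length at most `L`. In each component of the complement of
`B`, the vertex of smallest identifier fixes one of the two bipartition classes of the tree, and a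
vertex `v` moves to the point of the cycle whose index is its distance from the nearest breaker of
the right class, capped at `2q` or `2q+1` according to parity (`SimpleGraph.position`). Breakers
themselves sit at point `0 = 2q+1`, and since they are far apart, the choices made in different
components fit together (`SimpleGraph.IsTree.isPQColoring_position`).

To find breakers, put `k = 2q` and delete vertices in phases (`SimpleGraph.alive`): a phase first
deletes all *deep* vertices, those with only vertices of degree at most two within distance `k`,
and then deletes the leaves `k` times. The breakers of a phase are a ruling set of the deep
vertices, chosen bit by bit in the identifiers (`SimpleGraph.ruling`), with priority for the ends
of the paths that the deep vertices form. This costs `O(q)` per bit, and it places a breaker within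
distance `k` of each such end.

* In a rooted tree, the number of descendants of a surviving vertex doubles with every phase
  (`SimpleGraph.IsTree.two_pow_le_ncard_descendants`), so `O(log n)` phases delete everything.
* The leaf deletions of a phase use up all vertices within distance `k` of the deep ones, so
  breakers of different phases are far apart (`SimpleGraph.eq_of_mem_breakers`).
* A path that avoids the breakers cannot leave the set of surviving vertices and come back. Hence
  it ascends, stays on one level for `O(q log n)` steps, and descends, with `O(q)` steps per phase
  (`SimpleGraph.length_le_of_avoids`).

All of these objects are defined through bounded walks and comparisons of identifiers. They are
therefore invariant under bounded bisimulation (`SimpleGraph.Agree`), which relates a network to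
what one of its vertices sees (`SimpleGraph.agree_localView`).

**Lower bound.** There is a connected graph on `n` vertices with girth of order `log n` in which
every set of `n / 4` vertices spans an edge (`SimpleGraph.exists_noShortDetour_of_card`): add edges
greedily between distant vertices of small degree, each time destroying at least one percent of the
remaining independent sets of size at least `n / 4`. If an algorithm is too fast to see a cycle,
then its run at an edge of this graph is indistinguishable from its run on a breadth-first search
tree, so it would color the graph properly (`SimpleGraph.NoShortDetour.isPQColoring_run`). But in a
`(2q+1 : q)`-coloring some color is used by at least a third of the vertices, and these form an
independent set.
-/

namespace SimpleGraph

section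

variable {V : Type*} {G : SimpleGraph V} {A D : Set V}

/-! ### Walks inside a set of vertices -/

/-- There is a walk of length `t` from `x` to `y` all of whose vertices, ends included, lie
in `A`. -/
def WalkIn (G : SimpleGraph V) (A : Set V) : ℕ → V → V → Prop
  | 0, x, y => x ∈ A ∧ x = y
  | t + 1, x, y => x ∈ A ∧ ∃ z, G.Adj x z ∧ WalkIn G A t z y

/-- The first `L + 1` values of `p` form a walk that never turns back on the spot. In a tree, this
is a path. -/
structure NonBacktracking (G : SimpleGraph V) (p : ℕ → V) (L : ℕ) : Prop where
  adj : ∀ s, s < L → G.Adj (p s) (p (s + 1))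
  ne : ∀ s, s + 2 ≤ L → p s ≠ p (s + 2)

lemma WalkIn.left_mem {t : ℕ} {x y : V} (h : G.WalkIn A t x y) : x ∈ A := by
  cases t <;> exact h.1

lemma WalkIn.trans {s t : ℕ} {x y z : V} (h : G.WalkIn A s x y) (h' : G.WalkIn A t y z) :
    G.WalkIn A (s + t) x z := by
  induction s generalizing x with
  | zero =>
    obtain ⟨_, rfl⟩ := h
    simpa using h'
  | succ s ih =>
    obtain ⟨hx, w, hw, h⟩ := h
    rw [Nat.succ_add]
    exact ⟨hx, w, hw, ih h⟩

lemma WalkIn.right_mem {t : ℕ} {x y : V} (h : G.WalkIn A t x y) : y ∈ A := by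
  induction t generalizing x with
  | zero => exact h.2 ▸ h.1
  | succ t ih =>
    obtain ⟨_, _, _, h⟩ := h
    exact ih h

lemma WalkIn.symm {t : ℕ} {x y : V} (h : G.WalkIn A t x y) : G.WalkIn A t y x := by
  induction t generalizing x with
  | zero => exact ⟨h.right_mem, h.2.symm⟩
  | succ t ih =>
    obtain ⟨hx, z, hz, h⟩ := h
    exact (ih h).trans (t := 1) ⟨h.left_mem, x, hz.symm, hx, rfl⟩

/-- The last step of a walk. -/
lemma WalkIn.exists_last {t : ℕ} {x y : V} (h : G.WalkIn A (t + 1) x y) :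
    ∃ z, G.WalkIn A t x z ∧ G.Adj z y ∧ y ∈ A := by
  obtain ⟨hy, z, hz, h⟩ := h.symm
  exact ⟨z, h.symm, hz.symm, hy⟩

lemma walkIn_of_adj {p : ℕ → V} {s t : ℕ} (hadj : ∀ i, s ≤ i → i < t → G.Adj (p i) (p (i + 1)))
    (hA : ∀ i, s ≤ i → i ≤ t → p i ∈ A) (hst : s ≤ t) : G.WalkIn A (t - s) (p s) (p t) := by
  induction t, hst using Nat.le_induction with
  | base => simpa using ⟨hA s le_rfl le_rfl, rfl⟩
  | succ t hst ih =>
    rw [Nat.succ_sub hst]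
    exact (ih (fun i h h' => hadj i h (by omega)) (fun i h h' => hA i h (by omega))).trans (t := 1)
      ⟨hA t hst (by omega), _, hadj t hst (by omega), hA _ (by omega) le_rfl, rfl⟩

lemma NonBacktracking.walkIn {p : ℕ → V} {L : ℕ} (hp : G.NonBacktracking p L)
    (hA : ∀ s ≤ L, p s ∈ A) {s t : ℕ} (hst : s ≤ t) (ht : t ≤ L) :
    G.WalkIn A (t - s) (p s) (p t) :=
  walkIn_of_adj (fun i _ h => hp.adj i (by omega)) (fun i _ h => hA i (by omega)) hst

lemma NonBacktracking.reverse {p : ℕ → V} {L : ℕ} (hp : G.NonBacktracking p L) :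
    G.NonBacktracking (fun s => p (L - s)) L where
  adj s hs := by
    have := hp.adj (L - (s + 1)) (by omega)
    rw [show L - (s + 1) + 1 = L - s by omega] at this
    exact this.symm
  ne s hs := by
    have := hp.ne (L - (s + 2)) (by omega)
    rw [show L - (s + 2) + 2 = L - s by omega] at this
    exact this.symm

lemma NonBacktracking.segment {p : ℕ → V} {L : ℕ} (hp : G.NonBacktracking p L) {a m : ℕ}
    (h : a + m ≤ L) : G.NonBacktracking (fun s => p (a + s)) m where
  adj s hs := hp.adj (a + s) (by omega)
  ne s hs := hp.ne (a + s) (by omega)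

lemma Walk.IsPath.nonBacktracking {x y : V} {w : G.Walk x y} (hw : w.IsPath) :
    G.NonBacktracking w.getVert w.length where
  adj s hs := w.adj_getVert_succ hs
  ne s hs h := by
    have := hw.getVert_injOn (by simp; omega) (by simp; omega) h
    omega

lemma exists_walk_of_walkIn {t : ℕ} {x y : V} (h : G.WalkIn A t x y) :
    ∃ w : G.Walk x y, w.length = t ∧ ∀ z ∈ w.support, z ∈ A := by
  induction t generalizing x with
  | zero =>
    obtain ⟨hx, rfl⟩ := h
    exact ⟨.nil, rfl, by simpa using hx⟩
  | succ t ih =>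
    obtain ⟨hx, z, hz, h⟩ := h
    obtain ⟨w, hw, hs⟩ := ih h
    refine ⟨.cons hz w, by simp [hw], ?_⟩
    simpa using ⟨hx, hs⟩

/-- A walk inside `A` can be replaced by a path inside `A`. -/
lemma WalkIn.exists_nonBacktracking {t : ℕ} {x y : V} (h : G.WalkIn A t x y) :
    ∃ p L, L ≤ t ∧ G.NonBacktracking p L ∧ p 0 = x ∧ p L = y ∧ ∀ s ≤ L, p s ∈ A := by
  classical
  obtain ⟨w, hw, hs⟩ := exists_walk_of_walkIn h
  refine ⟨w.bypass.getVert, w.bypass.length, hw ▸ w.length_bypass_le_length,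
    w.bypass_isPath.nonBacktracking, by simp, by simp, fun s _ => ?_⟩
  exact hs _ (w.support_bypass_subset_support (Walk.getVert_mem_support _ _))

/-! ### Raking and compressing -/

/-- The vertex `x` has at least two neighbors in `A`. -/
def HasTwo (G : SimpleGraph V) (A : Set V) (x : V) : Prop :=
  ∃ y z, y ≠ z ∧ (y ∈ A ∧ G.Adj x y) ∧ (z ∈ A ∧ G.Adj x z)

/-- The vertex `x` has at least three neighbors in `A`. -/
def HasThree (G : SimpleGraph V) (A : Set V) (x : V) : Prop :=
  ∃ y z w, (y ≠ z ∧ y ≠ w ∧ z ≠ w) ∧ (y ∈ A ∧ G.Adj x y) ∧ (z ∈ A ∧ G.Adj x z) ∧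
    (w ∈ A ∧ G.Adj x w)

/-- What is left of `A` when its vertices with at most one neighbor in `A` are deleted. -/
def rake (G : SimpleGraph V) (A : Set V) : Set V := {x | x ∈ A ∧ G.HasTwo A x}

/-- The vertices of `A` from which no vertex with three neighbors in `A` is reached in `A` within
`k` steps: they lie in the middle of a long path of vertices of degree at most two. -/
def deep (G : SimpleGraph V) (k : ℕ) (A : Set V) : Set V :=
  {x | x ∈ A ∧ ∀ t ≤ k, ∀ y, G.WalkIn A t x y → ¬ G.HasThree A y}

/-- The vertices that survive the first `i` steps of the deletion process. A phase of the process
consists of `k + 1` steps: one that deletes the deep vertices, and `k` that delete the leaves. -/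
def alive (G : SimpleGraph V) (k : ℕ) : ℕ → Set V
  | 0 => Set.univ
  | i + 1 => if k + 1 ∣ i then alive G k i \ G.deep k (alive G k i) else G.rake (alive G k i)

lemma eq_or_eq_of_not_hasThree {x y z w : V} (h : ¬ G.HasThree A x) (hyz : y ≠ z)
    (hy : y ∈ A ∧ G.Adj x y) (hz : z ∈ A ∧ G.Adj x z) (hw : w ∈ A ∧ G.Adj x w) :
    w = y ∨ w = z := by
  by_contra! hne
  exact h ⟨y, z, w, ⟨hyz, hne.1.symm, hne.2.symm⟩, hy, hz, hw⟩

lemma deep_subset (G : SimpleGraph V) (k : ℕ) (A : Set V) : G.deep k A ⊆ A := fun _ h => h.1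

lemma not_hasThree_of_mem_deep {k : ℕ} {x : V} (hx : x ∈ G.deep k A) : ¬ G.HasThree A x :=
  hx.2 0 (Nat.zero_le k) x ⟨hx.1, rfl⟩

lemma alive_succ_subset (G : SimpleGraph V) (k i : ℕ) : G.alive k (i + 1) ⊆ G.alive k i := by
  rw [alive]
  split_ifs
  · exact Set.sdiff_subset
  · exact fun x hx => hx.1

lemma alive_anti (G : SimpleGraph V) (k : ℕ) : Antitone (G.alive k) :=
  antitone_nat_of_succ_le (G.alive_succ_subset k)

lemma alive_succ_of_dvd {k i : ℕ} (h : k + 1 ∣ i) :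
    G.alive k (i + 1) = G.alive k i \ G.deep k (G.alive k i) := by
  rw [alive, if_pos h]

lemma alive_succ_of_not_dvd {k i : ℕ} (h : ¬ k + 1 ∣ i) :
    G.alive k (i + 1) = G.rake (G.alive k i) := by
  rw [alive, if_neg h]

/-- A vertex with two neighbors in `alive i` can only be deleted in step `i` if it is deep. -/
lemma mem_deep_of_hasTwo {k i : ℕ} {x : V} (h : x ∈ G.alive k i) (h' : x ∉ G.alive k (i + 1))
    (h2 : G.HasTwo (G.alive k i) x) : k + 1 ∣ i ∧ x ∈ G.deep k (G.alive k i) := by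
  by_cases hi : k + 1 ∣ i
  · refine ⟨hi, ?_⟩
    rw [alive_succ_of_dvd hi] at h'
    by_contra hd
    exact h' ⟨h, hd⟩
  · rw [alive_succ_of_not_dvd hi] at h'
    exact absurd ⟨h, h2⟩ h'

/-- The neighborhood of deleted deep vertices consists of stubs, which the leaf deletions of the
same phase consume. -/
lemma not_mem_alive_of_walkIn_deep {k m t : ℕ} (hm : k + 1 ∣ m) (ht : t ≤ k) {d x : V}
    (hd : d ∈ G.deep k (G.alive k m)) (h : G.WalkIn (G.alive k m) t d x) :
    x ∉ G.alive k (m + 1 + t) := by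
  induction t generalizing x with
  | zero =>
    obtain ⟨_, rfl⟩ := h
    rw [Nat.add_zero, alive_succ_of_dvd hm]
    exact fun h => h.2 hd
  | succ t ih =>
    have h3 := hd.2 _ ht x h
    obtain ⟨z, hz, hzx, hx⟩ := h.exists_last
    have hz' := ih (by omega) hz
    have hdvd : ¬ k + 1 ∣ m + 1 + t := by
      intro h
      rw [add_assoc, Nat.dvd_add_right hm] at h
      exact absurd (Nat.le_of_dvd (by omega) h) (by omega)
    rw [← add_assoc, alive_succ_of_not_dvd hdvd]
    rintro ⟨-, y, w, hyw, ⟨hyA, hy⟩, ⟨hwA, hw⟩⟩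
    have hsub : G.alive k (m + 1 + t) ⊆ G.alive k m := G.alive_anti k (by omega)
    rcases eq_or_eq_of_not_hasThree h3 hyw ⟨hsub hyA, hy⟩ ⟨hsub hwA, hw⟩
      ⟨hz.right_mem, hzx.symm⟩ with rfl | rfl
    · exact hz' hyA
    · exact hz' hwA

lemma hasTwo_of_nonBacktracking {p : ℕ → V} {L : ℕ} (hp : G.NonBacktracking p L) {s : ℕ}
    (h0 : 0 < s) (hL : s < L) (h1 : p (s - 1) ∈ A) (h2 : p (s + 1) ∈ A) : G.HasTwo A (p s) := by
  obtain ⟨s, rfl⟩ := Nat.exists_eq_add_of_lt h0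
  simp only [Nat.zero_add, Nat.add_sub_cancel] at *
  exact ⟨_, _, hp.ne s (by omega), ⟨h1, (hp.adj s (by omega)).symm⟩, ⟨h2, hp.adj _ hL⟩⟩

lemma NonBacktracking.eq_or_eq {p : ℕ → V} {L : ℕ} (hp : G.NonBacktracking p L) {s : ℕ}
    (h0 : 0 < s) (hL : s < L) (h1 : p (s - 1) ∈ A) (h2 : p (s + 1) ∈ A)
    (h3 : ¬ G.HasThree A (p s)) {w : V} (hw : w ∈ A) (hadj : G.Adj (p s) w) :
    w = p (s - 1) ∨ w = p (s + 1) := by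
  obtain ⟨s, rfl⟩ := Nat.exists_eq_add_of_lt h0
  simp only [Nat.zero_add, Nat.add_sub_cancel] at *
  exact eq_or_eq_of_not_hasThree h3 (hp.ne s (by omega)) ⟨h1, (hp.adj s (by omega)).symm⟩
    ⟨h2, hp.adj _ hL⟩ ⟨hw, hadj⟩

/-- A walk that starts on a path without branching stays on the path or leaves through one of its
ends. -/
lemma WalkIn.mem_path_or_end {p : ℕ → V} {L : ℕ} (hp : G.NonBacktracking p L)
    (hA : ∀ s ≤ L, p s ∈ A) (h3 : ∀ s ≤ L, ¬ G.HasThree A (p s)) {t s : ℕ} (hs : s ≤ L) {y : V}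
    (h : G.WalkIn A t (p s) y) :
    (∃ s' ≤ L, y = p s') ∨ ∃ t' ≤ t, G.WalkIn A t' (p 0) y ∨ G.WalkIn A t' (p L) y := by
  induction t generalizing s with
  | zero => exact .inl ⟨s, hs, h.2.symm⟩
  | succ t ih =>
    rcases Nat.eq_zero_or_pos s with rfl | h0
    · exact .inr ⟨_, le_rfl, .inl h⟩
    rcases hs.eq_or_lt with rfl | hL
    · exact .inr ⟨_, le_rfl, .inr h⟩
    obtain ⟨hx, z, hz, h⟩ := h
    have key : ∃ s' ≤ L, z = p s' := by
      rcases hp.eq_or_eq h0 hL (hA _ (by omega)) (hA _ (by omega)) (h3 _ hs) h.left_mem hz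
        with h | h
      · exact ⟨_, by omega, h⟩
      · exact ⟨_, by omega, h⟩
    obtain ⟨s', hs', rfl⟩ := key
    rcases ih hs' h with h | ⟨t', ht', h⟩
    · exact .inl h
    · exact .inr ⟨t', by omega, h⟩

/-- Short paths between deep vertices consist of deep vertices. -/
lemma NonBacktracking.mem_deep {k : ℕ} {p : ℕ → V} {L : ℕ} (hp : G.NonBacktracking p L)
    (hA : ∀ s ≤ L, p s ∈ A) (hL : L ≤ k) (h0 : p 0 ∈ G.deep k A) (h1 : p L ∈ G.deep k A)
    {s : ℕ} (hs : s ≤ L) : p s ∈ G.deep k A := by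
  have h3 : ∀ s ≤ L, ¬ G.HasThree A (p s) := fun s hs =>
    h0.2 _ (by omega) _ (hp.walkIn hA (Nat.zero_le s) hs)
  refine ⟨hA s hs, fun t ht y hy => ?_⟩
  rcases WalkIn.mem_path_or_end hp hA h3 hs hy with ⟨s', hs', rfl⟩ | ⟨t', ht', h | h⟩
  · exact h3 s' hs'
  · exact h0.2 _ (by omega) _ h
  · exact h1.2 _ (by omega) _ h

lemma WalkIn.mem_of_closed {S : Set V} (hS : ∀ x ∈ S, ∀ y ∈ A, G.Adj x y → y ∈ S) {t : ℕ} {x y : V}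
    (hx : x ∈ S) (h : G.WalkIn A t x y) : y ∈ S := by
  induction t generalizing x with
  | zero => exact h.2 ▸ hx
  | succ t ih =>
    obtain ⟨_, z, hz, h⟩ := h
    exact ih (hS x hx z h.left_mem hz) h

end

section

variable {V : Type*} {G : SimpleGraph V} {A D : Set V}

/-! ### Ruling sets -/

/-- Stage `i` of the bitwise construction of a ruling set of `U` for the relation `R`: whenever two
related vertices of the previous stage have keys that agree above the bit in question but not in
it, the one with the larger key is dropped. -/
def ruling (key : V → ℕ) (R : V → V → Prop) (U : Set V) : ℕ → Set V
  | 0 => U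
  | i + 1 => {x | x ∈ ruling key R U i ∧ ∀ y ∈ ruling key R U i, R x y →
      key y / 2 ^ (i + 1) = key x / 2 ^ (i + 1) → key x / 2 ^ i ≤ key y / 2 ^ i}

lemma ruling_subset (key : V → ℕ) (R : V → V → Prop) (U : Set V) (i : ℕ) :
    ruling key R U i ⊆ U := by
  induction i with
  | zero => exact subset_rfl
  | succ i ih => exact fun x hx => ih hx.1

lemma key_eq_of_mem_ruling {key : V → ℕ} {R : V → V → Prop} (hR : ∀ {x y}, R x y → R y x)
    {U : Set V} {i : ℕ} {x y : V} (hx : x ∈ ruling key R U i) (hy : y ∈ ruling key R U i) (hxy : R x y)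
    (h : key x / 2 ^ i = key y / 2 ^ i) : key x = key y := by
  induction i with
  | zero => simpa using h
  | succ i ih =>
    exact ih hx.1 hy.1 (le_antisymm (hx.2 y hy.1 hxy h.symm) (hy.2 x hx.1 (hR hxy) h))

/-- A vertex that is dropped has a related vertex of smaller key that is not. -/
lemma exists_mem_ruling_succ {key : V → ℕ} {R : V → V → Prop} {U : Set V} {i : ℕ} {x : V}
    (hx : x ∈ ruling key R U i) :
    ∃ y ∈ ruling key R U (i + 1), y = x ∨ R x y ∧ key y < key x := by
  by_cases h : x ∈ ruling key R U (i + 1)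
  · exact ⟨x, h, .inl rfl⟩
  have : ∃ y ∈ ruling key R U i, R x y ∧ key y / 2 ^ (i + 1) = key x / 2 ^ (i + 1) ∧
      key y / 2 ^ i < key x / 2 ^ i := by
    by_contra! hcon
    exact h ⟨hx, hcon⟩
  obtain ⟨y, hy, hxy, heq, hlt⟩ := this
  refine ⟨y, ⟨hy, fun z _ _ hz => ?_⟩, .inr ⟨hxy, ?_⟩⟩
  · -- the quotient of `key y` is even, hence smallest possible
    rw [pow_succ, ← Nat.div_div_eq_div_mul, ← Nat.div_div_eq_div_mul] at heq hz
    omega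
  · by_contra! hle
    exact absurd (Nat.div_le_div_right (c := 2 ^ i) hle) (by omega)

/-! ### Breakers -/

/-- There is a walk of length at most `k` in `D` from `x` to `y`. -/
def Near (G : SimpleGraph V) (k : ℕ) (D : Set V) (x y : V) : Prop := ∃ t ≤ k, G.WalkIn D t x y

lemma Near.symm {k : ℕ} {x y : V} : G.Near k D x y → G.Near k D y x :=
  fun ⟨t, ht, h⟩ => ⟨t, ht, h.symm⟩

/-- The vertices of `D` with a neighbor in `A` outside `D`. -/
def boundaryIn (G : SimpleGraph V) (A D : Set V) : Set V :=
  {x | x ∈ D ∧ ∃ y, (y ∈ A ∧ y ∉ D) ∧ G.Adj x y}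

open Classical in
/-- The identifiers, modified so that the vertices of `S` come first. -/
noncomputable def priorityKey (ident : V → ℕ) (b : ℕ) (S : Set V) (x : V) : ℕ :=
  ident x + if x ∈ S then 0 else 2 ^ b

/-- The breakers of a set `A`: a ruling set of its deep vertices, in whose construction the boundary
of the set of deep vertices has priority. Here `b` is a bound for the number of binary digits of
the identifiers. -/
noncomputable def breakersIn (G : SimpleGraph V) (ident : V → ℕ) (k b : ℕ) (A : Set V) : Set V :=
  ruling (priorityKey ident b (G.boundaryIn A (G.deep k A))) (G.Near k (G.deep k A)) (G.deep k A)
    (b + 1)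

/-- The breakers of the first `N` phases of the deletion process. -/
noncomputable def breakers (G : SimpleGraph V) (ident : V → ℕ) (k b N : ℕ) : Set V :=
  {x | ∃ j < N, x ∈ G.breakersIn ident k b (G.alive k ((k + 1) * j))}

section

variable {ident : V → ℕ} {k b : ℕ}

lemma breakersIn_subset (G : SimpleGraph V) (ident : V → ℕ) (k b : ℕ) (A : Set V) :
    G.breakersIn ident k b A ⊆ G.deep k A := ruling_subset _ _ _ _

lemma eq_of_mem_breakersIn (hinj : Function.Injective ident) (hb : ∀ x, ident x < 2 ^ b) {x y : V}
    (hx : x ∈ G.breakersIn ident k b A) (hy : y ∈ G.breakersIn ident k b A)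
    (h : G.Near k (G.deep k A) x y) : x = y := by
  classical
  have hlt : ∀ z, priorityKey ident b (G.boundaryIn A (G.deep k A)) z < 2 ^ (b + 1) := by
    intro z
    have := hb z
    rw [priorityKey, pow_succ]
    split_ifs <;> omega
  have := key_eq_of_mem_ruling Near.symm hx hy h
    (by rw [Nat.div_eq_of_lt (hlt x), Nat.div_eq_of_lt (hlt y)])
  have hx' := hb x
  have hy' := hb y
  apply hinj
  rw [priorityKey, priorityKey] at this
  split_ifs at this <;> omega

lemma exists_mem_breakersIn {x : V} (hx : x ∈ G.deep k A) :
    ∃ y ∈ G.breakersIn ident k b A, ∃ t ≤ k * (b + 1), G.WalkIn (G.deep k A) t x y := by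
  suffices h : ∀ i, ∃ y ∈ ruling (priorityKey ident b (G.boundaryIn A (G.deep k A)))
      (G.Near k (G.deep k A)) (G.deep k A) i, ∃ t ≤ k * i, G.WalkIn (G.deep k A) t x y from
    h (b + 1)
  intro i
  induction i with
  | zero => exact ⟨x, hx, 0, le_rfl, hx, rfl⟩
  | succ i ih =>
    obtain ⟨y, hy, t, ht, hw⟩ := ih
    obtain ⟨z, hz, rfl | ⟨⟨s, hs, hs'⟩, -⟩⟩ := exists_mem_ruling_succ hy
    · exact ⟨_, hz, t, ht.trans (Nat.mul_le_mul_left _ (by omega)), hw⟩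
    · exact ⟨z, hz, t + s, by rw [Nat.mul_succ]; omega, hw.trans hs'⟩

/-- A component of the set of deep vertices is a path, so it has at most two boundary vertices. -/
lemma eq_or_eq_of_mem_boundaryIn {D : Set V} (hDA : D ⊆ A) (h3 : ∀ x ∈ D, ¬ G.HasThree A x)
    {x y z : V} (hx : x ∈ G.boundaryIn A D) (hy : y ∈ G.boundaryIn A D)
    (hz : z ∈ G.boundaryIn A D) {s t : ℕ} (hxy : G.WalkIn D s x y) (hyz : G.WalkIn D t y z)
    (hne : x ≠ y) : z = x ∨ z = y := by
  obtain ⟨p, L, -, hp, rfl, rfl, hpD⟩ := hxy.exists_nonBacktracking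
  have hL : 0 < L := Nat.pos_of_ne_zero (by rintro rfl; exact hne rfl)
  -- an end of the path has one neighbor on the path and another one outside `D`
  have hend : ∀ u v, v ∈ D → G.Adj u v → u ∈ G.boundaryIn A D → ∀ w ∈ D, G.Adj u w → w = v := by
    rintro u v hv huv ⟨hu, u', ⟨hu'A, hu'D⟩, huu'⟩ w hw huw
    rcases eq_or_eq_of_not_hasThree (h3 u hu) (y := v) (z := u') (by rintro rfl; exact hu'D hv)
      ⟨hDA hv, huv⟩ ⟨hu'A, huu'⟩ ⟨hDA hw, huw⟩ with h | rfl
    · exact h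
    · exact absurd hw hu'D
  have hzp : z ∈ {u | ∃ i ≤ L, u = p i} := by
    refine WalkIn.mem_of_closed ?_ ⟨L, le_rfl, rfl⟩ hyz
    rintro _ ⟨i, hi, rfl⟩ w hw hadj
    rcases Nat.eq_zero_or_pos i with rfl | h0
    · exact ⟨1, hL, hend _ _ (hpD 1 hL) (hp.adj 0 hL) hx w hw hadj⟩
    rcases hi.eq_or_lt with rfl | hi
    · refine ⟨i - 1, by omega, hend _ _ (hpD _ (by omega)) ?_ hy w hw hadj⟩
      have := hp.adj (i - 1) (by omega)
      rw [Nat.sub_add_cancel h0] at this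
      exact this.symm
    · rcases hp.eq_or_eq h0 hi (hDA (hpD _ (by omega))) (hDA (hpD _ (by omega)))
        (h3 _ (hpD _ hi.le)) (hDA hw) hadj with h | h
      · exact ⟨_, by omega, h⟩
      · exact ⟨_, by omega, h⟩
  obtain ⟨i, hi, rfl⟩ := hzp
  by_contra! hcon
  have h0 : 0 < i := Nat.pos_of_ne_zero (by rintro rfl; exact hcon.1 rfl)
  have hi' : i < L := lt_of_le_of_ne hi (by rintro rfl; exact hcon.2 rfl)
  obtain ⟨hzD, w, ⟨hwA, hwD⟩, hzw⟩ := hz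
  rcases hp.eq_or_eq h0 hi' (hDA (hpD _ (by omega))) (hDA (hpD _ (by omega)))
    (h3 _ hzD) hwA hzw with rfl | rfl
  · exact hwD (hpD _ (by omega))
  · exact hwD (hpD _ (by omega))

/-- As boundary vertices have priority, they have breakers close by. -/
lemma exists_near_mem_breakersIn (hb : ∀ x, ident x < 2 ^ b) {x : V}
    (hx : x ∈ G.boundaryIn A (G.deep k A)) :
    ∃ y ∈ G.breakersIn ident k b A, G.Near k (G.deep k A) x y := by
  classical
  set D := G.deep k A
  set key := priorityKey ident b (G.boundaryIn A D) with hkey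
  suffices h : ∀ i, ∃ y ∈ ruling key (G.Near k D) D i, y ∈ G.boundaryIn A D ∧ G.Near k D x y by
    obtain ⟨y, hy, -, h⟩ := h (b + 1)
    exact ⟨y, hy, h⟩
  have hlow : ∀ y z, y ∈ G.boundaryIn A D → z ∈ D → key z < key y → z ∈ G.boundaryIn A D := by
    intro y z hy _ hlt
    by_contra hz
    have := hb y
    simp only [hkey, priorityKey, if_pos hy, if_neg hz] at hlt
    omega
  have hself : G.Near k D x x := ⟨0, Nat.zero_le k, hx.1, rfl⟩
  intro i
  induction i with
  | zero => exact ⟨x, hx.1, hx, hself⟩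
  | succ i ih =>
    obtain ⟨y, hy, hyB, hxy⟩ := ih
    obtain ⟨z, hz, rfl | ⟨hyz, hlt⟩⟩ := exists_mem_ruling_succ hy
    · exact ⟨_, hz, hyB, hxy⟩
    have hzB := hlow y z hyB (ruling_subset _ _ _ _ hz) hlt
    rcases eq_or_ne x y with rfl | hne
    · exact ⟨z, hz, hzB, hyz⟩
    obtain ⟨s, _, hs⟩ := hxy
    obtain ⟨t, _, ht⟩ := hyz
    rcases eq_or_eq_of_mem_boundaryIn (G.deep_subset k A) (fun _ => not_hasThree_of_mem_deep)
      hx hyB hzB hs ht hne with rfl | rfl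
    · exact ⟨_, hz, hzB, hself⟩
    · exact absurd hlt (lt_irrefl _)

/-- Distinct breakers are joined by no path of length at most `k`. -/
lemma eq_of_mem_breakers (hinj : Function.Injective ident) (hb : ∀ x, ident x < 2 ^ b) {N : ℕ}
    {p : ℕ → V} {L : ℕ} (hp : G.NonBacktracking p L) (hL : L ≤ k)
    (h0 : p 0 ∈ G.breakers ident k b N) (h1 : p L ∈ G.breakers ident k b N) : p 0 = p L := by
  classical
  obtain ⟨j, -, h0⟩ := h0
  obtain ⟨j', -, h1⟩ := h1
  have hout : ∀ {j x}, x ∈ G.breakersIn ident k b (G.alive k ((k + 1) * j)) →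
      x ∉ G.alive k ((k + 1) * j + 1) := by
    intro j x hx
    rw [alive_succ_of_dvd (dvd_mul_right _ _)]
    exact fun h => h.2 (breakersIn_subset _ _ _ _ _ hx)
  have hin : ∀ {j x}, x ∈ G.breakersIn ident k b (G.alive k ((k + 1) * j)) →
      x ∈ G.alive k ((k + 1) * j) := fun hx => hx |> breakersIn_subset _ _ _ _ _ |> fun h => h.1
  have huniq : ∀ {x i m}, x ∈ G.alive k i → x ∉ G.alive k (m + 1) → i ≤ m := by
    intro x i m hi hm
    by_contra! h
    exact hm (G.alive_anti k h hi)
  -- the first step that deletes a vertex of the path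
  have hex : ∃ m, ∃ s ≤ L, p s ∉ G.alive k (m + 1) := ⟨_, 0, Nat.zero_le _, hout h0⟩
  obtain ⟨m, ⟨s, hs, hsm⟩, hmin⟩ : ∃ m, (∃ s ≤ L, p s ∉ G.alive k (m + 1)) ∧
      ∀ s ≤ L, p s ∈ G.alive k m := by
    refine ⟨Nat.find hex, Nat.find_spec hex, fun s hs => ?_⟩
    rcases hm : Nat.find hex with _ | m
    · trivial
    · by_contra h
      exact Nat.find_min hex (m := m) (by omega) ⟨s, hs, h⟩
  have hdeep : k + 1 ∣ m ∧ p s ∈ G.deep k (G.alive k m) := by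
    have hend : ∀ {j}, p s ∈ G.breakersIn ident k b (G.alive k ((k + 1) * j)) →
        k + 1 ∣ m ∧ p s ∈ G.deep k (G.alive k m) := by
      intro j hj
      have : m = (k + 1) * j :=
        le_antisymm (huniq (hmin s hs) (hout hj)) (huniq (hin hj) hsm)
      exact this ▸ ⟨dvd_mul_right _ _, breakersIn_subset _ _ _ _ _ hj⟩
    rcases Nat.eq_zero_or_pos s with rfl | hs0
    · exact hend h0
    rcases hs.eq_or_lt with rfl | hsL
    · exact hend h1
    exact mem_deep_of_hasTwo (hmin s hs) hsm
      (hasTwo_of_nonBacktracking hp hs0 hsL (hmin _ (by omega)) (hmin _ (by omega)))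
  obtain ⟨hdvd, hd⟩ := hdeep
  have hphase : ∀ {j x}, x ∈ G.breakersIn ident k b (G.alive k ((k + 1) * j)) →
      x ∈ G.alive k m → x ∉ G.alive k (m + 1 + k) → m = (k + 1) * j := by
    intro j x hj hxm hxm'
    have h1 := huniq hxm (hout hj)
    have h2 := huniq (m := m + k) (hin hj) (by rwa [Nat.add_right_comm])
    obtain ⟨c, rfl⟩ := hdvd
    have : j ≤ c := by
      by_contra! h
      have := Nat.mul_le_mul_left (k + 1) (Nat.succ_le_of_lt h)
      rw [Nat.succ_eq_add_one, mul_add] at this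
      omega
    exact le_antisymm h1 (Nat.mul_le_mul_left _ this)
  have hout' : ∀ {x t}, t ≤ k → G.WalkIn (G.alive k m) t (p s) x → x ∉ G.alive k (m + 1 + k) :=
    fun {x t} ht hw h => not_mem_alive_of_walkIn_deep hdvd ht hd hw
      (G.alive_anti k (by omega) h)
  obtain rfl := hphase h0 (hmin 0 (Nat.zero_le _))
    (hout' (by omega) (hp.walkIn hmin (Nat.zero_le s) hs).symm)
  rw [← hphase h1 (hmin L le_rfl) (hout' (by omega) (hp.walkIn hmin hs le_rfl))] at h1
  refine eq_of_mem_breakersIn hinj hb h0 h1 ⟨L - 0, by omega, hp.walkIn (fun i hi => ?_)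
    (Nat.zero_le L) le_rfl⟩
  exact hp.mem_deep hmin hL (breakersIn_subset _ _ _ _ _ h0) (breakersIn_subset _ _ _ _ _ h1) hi

/-! ### Paths without breakers are short -/

/-- A path without breakers that starts and ends in `alive i` stays there: a vertex deleted
earlier would be deep, and the path would traverse its whole component of the set of deep vertices,
which contains a breaker. -/
lemma mem_alive_of_avoids {N i : ℕ} (hi : i ≤ (k + 1) * N) {p : ℕ → V} {L : ℕ}
    (hp : G.NonBacktracking p L) (hB : ∀ s ≤ L, p s ∉ G.breakers ident k b N)
    (h0 : p 0 ∈ G.alive k i) (h1 : p L ∈ G.alive k i) {s : ℕ} (hs : s ≤ L) :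
    p s ∈ G.alive k i := by
  induction i generalizing s with
  | zero => trivial
  | succ i ih =>
    have hin : ∀ s ≤ L, p s ∈ G.alive k i := fun s hs =>
      ih (by omega) (G.alive_succ_subset k i h0) (G.alive_succ_subset k i h1) hs
    by_contra hcon
    have hs0 : 0 < s := Nat.pos_of_ne_zero (by rintro rfl; exact hcon h0)
    have hsL : s < L := lt_of_le_of_ne hs (by rintro rfl; exact hcon h1)
    obtain ⟨⟨j, rfl⟩, hd⟩ := mem_deep_of_hasTwo (hin s hs) hcon
      (hasTwo_of_nonBacktracking hp hs0 hsL (hin _ (by omega)) (hin _ (by omega)))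
    rw [alive_succ_of_dvd (dvd_mul_right _ _)] at h0 h1
    obtain ⟨y, hy, t, -, hw⟩ := exists_mem_breakersIn (ident := ident) (b := b) hd
    have : y ∈ {u | ∃ r, 0 < r ∧ r < L ∧ u = p r ∧ u ∈ G.deep k (G.alive k ((k + 1) * j))} := by
      refine WalkIn.mem_of_closed ?_ ⟨s, hs0, hsL, rfl, hd⟩ hw
      rintro _ ⟨r, hr0, hrL, rfl, hr⟩ w hwD hadj
      rcases hp.eq_or_eq hr0 hrL (hin _ (by omega)) (hin _ (by omega))
        (not_hasThree_of_mem_deep hr) (G.deep_subset _ _ hwD) hadj with rfl | rfl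
      · refine ⟨_, Nat.pos_of_ne_zero fun h => ?_, by omega, rfl, hwD⟩
        exact h0.2 (h ▸ hwD)
      · refine ⟨_, by omega, lt_of_le_of_ne hrL fun h => ?_, rfl, hwD⟩
        exact h1.2 (h ▸ hwD)
    obtain ⟨r, -, hrL, rfl, -⟩ := this
    exact hB r hrL.le ⟨j, Nat.lt_of_mul_lt_mul_left (a := k + 1) (by omega), hy⟩

/-- A walk of deep vertices that starts on a path far from its ends stays on the path. -/
lemma WalkIn.mem_path {p : ℕ → V} {L : ℕ} (hp : G.NonBacktracking p L) (hDA : D ⊆ A)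
    (h3 : ∀ x ∈ D, ¬ G.HasThree A x) (hA : ∀ s ≤ L, p s ∈ A) {s t : ℕ} {y : V}
    (h : G.WalkIn D t (p s) y) (hL : s + t ≤ L) (h0 : t ≤ s ∨ p 0 ∉ D) : ∃ r ≤ L, y = p r := by
  induction t generalizing s with
  | zero => exact ⟨s, hL, h.2.symm⟩
  | succ t ih =>
    obtain ⟨hs, z, hz, h⟩ := h
    have hs0 : 0 < s := by
      rcases h0 with h0 | h0
      · omega
      · exact Nat.pos_of_ne_zero (by rintro rfl; exact h0 hs)
    rcases hp.eq_or_eq hs0 (by omega) (hA _ (by omega)) (hA _ (by omega)) (h3 _ hs)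
      (hDA h.left_mem) hz with rfl | rfl
    · exact ih h (by omega) (h0.imp_left (by omega))
    · exact ih h (by omega) (h0.imp_left (by omega))

/-- A bound for the radius of the surroundings of a vertex that matter for the first `i` steps of the
deletion process, and also for the length of paths without breakers that leave `alive i` with their
first edge. -/
def phaseRadius (k : ℕ) : ℕ → ℕ
  | 0 => 0
  | i + 1 => phaseRadius k i + if k + 1 ∣ i then k + 1 else 1

lemma phaseRadius_mono (k : ℕ) : Monotone (phaseRadius k) :=
  monotone_nat_of_le_succ fun _ => Nat.le_add_right _ _

lemma phaseRadius_le (k i : ℕ) : phaseRadius k i ≤ i + k * ((i + k) / (k + 1)) := by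
  induction i with
  | zero => simp [phaseRadius]
  | succ i ih =>
    rw [phaseRadius, Nat.add_right_comm i 1 k, Nat.succ_div]
    have : k + 1 ∣ i + k + 1 ↔ k + 1 ∣ i := by rw [add_assoc, Nat.dvd_add_left dvd_rfl]
    simp only [this]
    split_ifs
    · rw [mul_add]; omega
    · rw [mul_add]; omega

lemma le_phaseRadius (hb : ∀ x, ident x < 2 ^ b) {N i : ℕ} (hi : i ≤ (k + 1) * N) {p : ℕ → V}
    {L : ℕ} (hp : G.NonBacktracking p L) (hB : ∀ s ≤ L, p s ∉ G.breakers ident k b N)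
    (h0 : p 0 ∈ G.alive k i) (h1 : ∀ s, 0 < s → s ≤ L → p s ∉ G.alive k i) :
    L ≤ phaseRadius k i := by
  classical
  induction i generalizing p L with
  | zero =>
    by_contra! h
    exact h1 L (by simpa [phaseRadius] using h) le_rfl trivial
  | succ i ih =>
    -- the last vertex of the path in `alive i`
    obtain ⟨e, heL, he, hmax⟩ : ∃ e ≤ L, p e ∈ G.alive k i ∧
        ∀ s, e < s → s ≤ L → p s ∉ G.alive k i :=
      ⟨Nat.findGreatest (fun s => p s ∈ G.alive k i) L, Nat.findGreatest_le _,
        Nat.findGreatest_spec (P := fun s => p s ∈ G.alive k i) (Nat.zero_le L)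
          (G.alive_succ_subset k i h0),
        fun s hs hL => Nat.findGreatest_is_greatest hs hL⟩
    have hseg : G.NonBacktracking p e := by simpa using hp.segment (a := 0) (m := e) (by omega)
    have hin : ∀ s ≤ e, p s ∈ G.alive k i := fun s hs =>
      mem_alive_of_avoids (by omega) hseg (fun s hs => hB s (by omega))
        (G.alive_succ_subset k i h0) he hs
    have htail : L - e ≤ phaseRadius k i :=
      ih (by omega) (hp.segment (a := e) (by omega)) (fun s hs => hB _ (by omega)) he
        (fun s hs hL => hmax _ (by omega) (by omega))
    rw [phaseRadius]
    split_ifs with hdvd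
    · obtain ⟨j, rfl⟩ := hdvd
      suffices e ≤ k + 1 by omega
      by_contra! hlt
      rw [alive_succ_of_dvd (dvd_mul_right _ _)] at h0 h1
      have hd : p 1 ∈ G.deep k (G.alive k ((k + 1) * j)) := by
        by_contra h
        exact h1 1 one_pos (by omega) ⟨hin 1 (by omega), h⟩
      obtain ⟨y, hy, t, ht, hw⟩ := exists_near_mem_breakersIn hb
        (A := G.alive k ((k + 1) * j)) (x := p 1)
        ⟨hd, p 0, ⟨h0.1, h0.2⟩, (hp.adj 0 (by omega)).symm⟩
      obtain ⟨r, hr, rfl⟩ := hw.mem_path hseg (G.deep_subset _ _)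
        (fun _ => not_hasThree_of_mem_deep) hin (by omega) (.inr h0.2)
      exact hB r (by omega) ⟨j, Nat.lt_of_mul_lt_mul_left (a := k + 1) (by omega), hy⟩
    · suffices e ≤ 1 by omega
      by_contra! hlt
      apply h1 1 one_pos (by omega)
      rw [alive_succ_of_not_dvd hdvd]
      exact ⟨hin 1 (by omega), hasTwo_of_nonBacktracking hseg one_pos hlt (hin _ (by omega))
        (hin _ (by omega))⟩

/-- If the deletion process ends within `N` phases, then paths without breakers are short: there
is a part in the set of vertices that are deleted last on the path, and on either side of it the
path descends. -/
lemma length_le_of_avoids (hb : ∀ x, ident x < 2 ^ b) {N : ℕ}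
    (hN : G.alive k ((k + 1) * N) = ∅) {p : ℕ → V} {L : ℕ} (hp : G.NonBacktracking p L)
    (hB : ∀ s ≤ L, p s ∉ G.breakers ident k b N) :
    L ≤ 2 * phaseRadius k ((k + 1) * N) + 2 * (k * (b + 1)) + 1 := by
  classical
  obtain ⟨i, hi, ⟨s, hsL, hs⟩, hmax⟩ : ∃ i < (k + 1) * N, (∃ s ≤ L, p s ∈ G.alive k i) ∧
      ∀ s ≤ L, p s ∉ G.alive k (i + 1) := by
    have hex : ∃ i, ∀ s ≤ L, p s ∉ G.alive k i := ⟨(k + 1) * N, by simp [hN]⟩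
    have hle : Nat.find hex ≤ (k + 1) * N := Nat.find_min' hex (by simp [hN])
    rcases hi : Nat.find hex with _ | i
    · have := Nat.find_spec hex 0 (Nat.zero_le L)
      rw [hi] at this
      exact absurd trivial this
    · refine ⟨i, by omega, ?_, hi ▸ Nat.find_spec hex⟩
      have := Nat.find_min hex (m := i) (by omega)
      push Not at this
      exact this
  -- the first and the last vertex of the path in `alive i`
  have hex : ∃ a, p a ∈ G.alive k i := ⟨s, hs⟩
  obtain ⟨a, haL, ha, hamin⟩ : ∃ a ≤ L, p a ∈ G.alive k i ∧ ∀ r < a, p r ∉ G.alive k i :=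
    ⟨Nat.find hex, (Nat.find_min' hex hs).trans hsL, Nat.find_spec hex,
      fun r hr => Nat.find_min hex hr⟩
  obtain ⟨e, heL, he, hemax⟩ : ∃ e ≤ L, p e ∈ G.alive k i ∧
      ∀ r, e < r → r ≤ L → p r ∉ G.alive k i :=
    ⟨Nat.findGreatest (fun s => p s ∈ G.alive k i) L, Nat.findGreatest_le _,
      Nat.findGreatest_spec (P := fun s => p s ∈ G.alive k i) hsL hs,
      fun s hs hL => Nat.findGreatest_is_greatest hs hL⟩
  have hae : a ≤ e := by
    by_contra! h
    exact hamin e h he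
  have htail : L - e ≤ phaseRadius k i :=
    le_phaseRadius hb hi.le (hp.segment (a := e) (by omega)) (fun s hs => hB _ (by omega)) he
      (fun s hs hL => hemax _ (by omega) (by omega))
  have hhead : a ≤ phaseRadius k i := by
    have hrev : G.NonBacktracking (fun s => p (a - s)) a := by
      simpa using (hp.segment (a := 0) (m := a) (by omega)).reverse
    exact le_phaseRadius hb hi.le hrev (fun s hs => hB _ (by omega)) (by simpa using ha)
      (fun s hs hL => hamin _ (by omega))
  have hseg : G.NonBacktracking (fun s => p (a + s)) (e - a) := hp.segment (by omega)
  have hin : ∀ s ≤ e - a, p (a + s) ∈ G.alive k i := fun s hs =>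
    mem_alive_of_avoids hi.le hseg (fun s hs => hB _ (by omega)) ha
      (by simpa [Nat.add_sub_cancel' hae] using he) hs
  have hmono := phaseRadius_mono k hi.le
  suffices e - a ≤ 2 * (k * (b + 1)) + 1 by omega
  by_contra! hlt
  have hmid := hmax (a + (k * (b + 1) + 1)) (by omega)
  obtain ⟨⟨j, rfl⟩, hd⟩ := mem_deep_of_hasTwo (hin _ (by omega)) hmid
    (hasTwo_of_nonBacktracking hseg (by omega) (by omega) (hin _ (by omega)) (hin _ (by omega)))
  obtain ⟨y, hy, t, ht, hw⟩ := exists_mem_breakersIn (ident := ident) (b := b) hd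
  obtain ⟨r, hr, rfl⟩ := WalkIn.mem_path hseg (G.deep_subset _ _)
    (fun _ => not_hasThree_of_mem_deep) hin (s := k * (b + 1) + 1) hw (by omega)
    (.inl (by omega))
  exact hB _ (by omega) ⟨j, Nat.lt_of_mul_lt_mul_left (a := k + 1) (by omega), hy⟩

end

end

section

variable {V : Type*} {G : SimpleGraph V} {A D : Set V}

/-! ### The number of phases -/

/-- The descendants of `w` in the tree `G` rooted at `r`. -/
def descendants (G : SimpleGraph V) (r w : V) : Set V :=
  {x | G.dist r x = G.dist r w + G.dist w x}

section

variable {r : V}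

lemma IsTree.eq_of_dist_lt (hG : G.IsTree) {x y z : V} (hy : G.Adj x y) (hz : G.Adj x z)
    (hyr : G.dist r y < G.dist r x) (hzr : G.dist r z < G.dist r x) : y = z := by
  have key : ∀ y, G.Adj x y → G.dist r y < G.dist r x →
      ∃ w : G.Walk r x, w.IsPath ∧ w.penultimate = y := by
    intro y hy hyr
    obtain ⟨w, hw⟩ := hG.connected.exists_walk_length_eq_dist r y
    refine ⟨w.concat hy.symm, Walk.isPath_of_length_eq_dist _ ?_, by simp⟩
    rw [Walk.length_concat, hw]
    rcases hG.dist_eq_dist_add_one_of_adj r hy with h | h <;> omega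
  obtain ⟨w, hw, rfl⟩ := key y hy hyr
  obtain ⟨w', hw', rfl⟩ := key z hz hzr
  rw [hG.existsUnique_path r x |>.unique hw hw']

lemma IsTree.child_mem_descendants (hG : G.IsTree) {w x y : V} (hx : x ∈ G.descendants r w)
    (hxy : G.Adj x y) (hy : G.dist r y = G.dist r x + 1) : y ∈ G.descendants r w := by
  have h1 : G.dist r y ≤ G.dist r w + G.dist w y := hG.connected.dist_triangle
  have h2 : G.dist w y ≤ G.dist w x + G.dist x y := hG.connected.dist_triangle
  rw [dist_eq_one_iff_adj.2 hxy] at h2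
  change G.dist r x = _ at hx
  change G.dist r y = _
  omega

/-- An edge leaves the set of descendants of `w` only at `w` itself. -/
lemma IsTree.adj_mem_descendants (hG : G.IsTree) {w x y : V} (hx : x ∈ G.descendants r w)
    (hne : x ≠ w) (hxy : G.Adj x y) : y ∈ G.descendants r w := by
  rcases hG.dist_eq_dist_add_one_of_adj r hxy with h | h
  · obtain ⟨p, hp⟩ := hG.connected.exists_walk_length_eq_dist x w
    rcases p with _ | ⟨hz, p⟩
    · exact absurd rfl hne
    rename_i z
    rw [Walk.length_cons] at hp
    have h1 : G.dist z w ≤ p.length := dist_le p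
    have h2 : G.dist r z ≤ G.dist r w + G.dist w z := hG.connected.dist_triangle
    rw [dist_comm] at h1 hp
    change G.dist r x = _ at hx
    obtain rfl := hG.eq_of_dist_lt (r := r) hxy hz (by omega) (by omega)
    change G.dist r y = _
    have h3 : G.dist r y ≤ G.dist r w + G.dist w y := hG.connected.dist_triangle
    omega
  · exact hG.child_mem_descendants hx hxy h

lemma IsTree.mem_descendants_of_walkIn (hG : G.IsTree) {w x y : V} {t : ℕ}
    (hx : x ∈ G.descendants r w) (hd : G.dist r w + t ≤ G.dist r x) (h : G.WalkIn A t x y) :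
    y ∈ G.descendants r w := by
  induction t generalizing x with
  | zero => exact h.2 ▸ hx
  | succ t ih =>
    obtain ⟨_, z, hz, h⟩ := h
    refine ih (hG.adj_mem_descendants hx (by rintro rfl; omega) hz) ?_ h
    rcases hG.dist_eq_dist_add_one_of_adj r hz with h | h <;> omega

lemma IsTree.descendants_subset (hG : G.IsTree) {w x : V} (hx : x ∈ G.descendants r w) :
    G.descendants r x ⊆ G.descendants r w := by
  intro y hy
  have h1 : G.dist r y ≤ G.dist r w + G.dist w y := hG.connected.dist_triangle
  have h2 : G.dist w y ≤ G.dist w x + G.dist x y := hG.connected.dist_triangle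
  change G.dist r x = _ at hx
  change G.dist r y = _ at hy
  change G.dist r y = _
  omega

/-- In a rooted tree, vertices of the same depth have disjoint sets of descendants. -/
lemma IsTree.disjoint_descendants (hG : G.IsTree) {x y : V} (hxy : x ≠ y)
    (hd : G.dist r x = G.dist r y) : Disjoint (G.descendants r x) (G.descendants r y) := by
  rw [Set.disjoint_left]
  intro z hx hy
  have key : ∀ x, z ∈ G.descendants r x →
      ∃ w : G.Walk r z, w.IsPath ∧ w.getVert (G.dist r x) = x := by
    intro x hx
    obtain ⟨w, hw⟩ := hG.connected.exists_walk_length_eq_dist r x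
    obtain ⟨w', hw'⟩ := hG.connected.exists_walk_length_eq_dist x z
    refine ⟨w.append w', Walk.isPath_of_length_eq_dist _ ?_, ?_⟩
    · rw [Walk.length_append, hw, hw']
      exact Eq.symm hx
    · rw [← hw, Walk.getVert_append]
      simp
  obtain ⟨w, hw, h⟩ := key x hx
  obtain ⟨w', hw', h'⟩ := key y hy
  rw [hG.existsUnique_path r z |>.unique hw hw', hd] at h
  exact hxy (h.symm.trans h')

/-- At most one of the neighbors of a vertex is closer to the root than the vertex itself. -/
lemma IsTree.exists_child (hG : G.IsTree) (r : V) {x : V} (h : G.HasTwo A x) :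
    ∃ y ∈ A, G.Adj x y ∧ G.dist r y = G.dist r x + 1 := by
  obtain ⟨y, z, hyz, ⟨hyA, hy⟩, ⟨hzA, hz⟩⟩ := h
  rcases hG.dist_eq_dist_add_one_of_adj r hy with h | h
  · rcases hG.dist_eq_dist_add_one_of_adj r hz with h' | h'
    · exact absurd (hG.eq_of_dist_lt hy hz (r := r) (by omega) (by omega)) hyz
    · exact ⟨z, hzA, hz, h'⟩
  · exact ⟨y, hyA, hy, h⟩

lemma IsTree.exists_two_children (hG : G.IsTree) (r : V) {x : V} (h : G.HasThree A x) :
    ∃ y z, y ≠ z ∧ (y ∈ A ∧ G.Adj x y ∧ G.dist r y = G.dist r x + 1) ∧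
      (z ∈ A ∧ G.Adj x z ∧ G.dist r z = G.dist r x + 1) := by
  obtain ⟨a, b, c, ⟨hab, hac, hbc⟩, ha, hb, hc⟩ := h
  obtain ⟨y, hyA, hy, hyd⟩ := hG.exists_child r (A := A) ⟨a, b, hab, ha, hb⟩
  have h2 : G.HasTwo (A \ {y}) x := by
    by_cases hay : a = y
    · exact ⟨b, c, hbc, ⟨⟨hb.1, by simpa [← hay] using hab.symm⟩, hb.2⟩,
        ⟨⟨hc.1, by simpa [← hay] using hac.symm⟩, hc.2⟩⟩
    · by_cases hby : b = y
      · exact ⟨a, c, hac, ⟨⟨ha.1, by simpa using hay⟩, ha.2⟩,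
          ⟨⟨hc.1, by simpa [← hby] using hbc.symm⟩, hc.2⟩⟩
      · exact ⟨a, b, hab, ⟨⟨ha.1, by simpa using hay⟩, ha.2⟩, ⟨⟨hb.1, by simpa using hby⟩, hb.2⟩⟩
  obtain ⟨z, hzA, hz, hzd⟩ := hG.exists_child r h2
  exact ⟨y, z, fun h => hzA.2 h.symm, ⟨hyA, hy, hyd⟩, ⟨hzA.1, hz, hzd⟩⟩

/-- The number of descendants of a surviving vertex doubles with every phase. A vertex `w` that
survives a phase has, at distance `k` below it, a vertex that is not deep, so that within
distance `2 * k` below `w` there is a vertex with two children that survived the previous phase. -/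
lemma IsTree.two_pow_le_ncard_descendants [Finite V] (hG : G.IsTree) (r : V) {k j : ℕ} {w : V}
    (hw : w ∈ G.alive k ((k + 1) * j)) : 2 ^ j ≤ (G.descendants r w).ncard := by
  induction j generalizing w with
  | zero =>
    rw [pow_zero, Nat.one_le_iff_ne_zero, ← Nat.pos_iff_ne_zero, Set.ncard_pos]
    exact ⟨w, by simp [descendants]⟩
  | succ j ih =>
    have hdesc : ∀ s ≤ k, ∃ x ∈ G.alive k ((k + 1) * j + (k + 1 - s)), x ∈ G.descendants r w ∧
        G.dist r x = G.dist r w + s := by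
      intro s hs
      induction s with
      | zero => exact ⟨w, by simpa [mul_add] using hw, by simp [descendants], rfl⟩
      | succ s ihs =>
        obtain ⟨x, hx, hxw, hxd⟩ := ihs (by omega)
        rw [show (k + 1) * j + (k + 1 - s) = (k + 1) * j + (k - s) + 1 by omega,
          alive_succ_of_not_dvd] at hx
        · obtain ⟨y, hyA, hy, hyd⟩ := hG.exists_child r hx.2
          refine ⟨y, ?_, hG.child_mem_descendants hxw hy hyd, by omega⟩
          rwa [show k + 1 - (s + 1) = k - s by omega]
        · rw [Nat.dvd_add_right (dvd_mul_right _ _)]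
          exact fun h => absurd (Nat.le_of_dvd (by omega) h) (by omega)
    obtain ⟨x, hx, hxw, hxd⟩ := hdesc k le_rfl
    rw [Nat.add_sub_cancel_left, alive_succ_of_dvd (dvd_mul_right _ _)] at hx
    obtain ⟨t, ht, y, hy, h3⟩ : ∃ t ≤ k, ∃ y, G.WalkIn (G.alive k ((k + 1) * j)) t x y ∧
        G.HasThree (G.alive k ((k + 1) * j)) y := by
      by_contra! h
      exact hx.2 ⟨hx.1, h⟩
    have hyw := hG.mem_descendants_of_walkIn hxw (by omega) hy
    obtain ⟨a, b, hab, ⟨haA, ha, had⟩, ⟨hbA, hb, hbd⟩⟩ := hG.exists_two_children r h3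
    calc 2 ^ (j + 1) = 2 ^ j + 2 ^ j := by ring
      _ ≤ (G.descendants r a).ncard + (G.descendants r b).ncard := add_le_add (ih haA) (ih hbA)
      _ = (G.descendants r a ∪ G.descendants r b).ncard :=
          (Set.ncard_union_eq (hG.disjoint_descendants hab (had.trans hbd.symm))).symm
      _ ≤ (G.descendants r w).ncard := Set.ncard_le_ncard (Set.union_subset
          (hG.descendants_subset (hG.child_mem_descendants hyw ha had))
          (hG.descendants_subset (hG.child_mem_descendants hyw hb hbd)))

/-- After logarithmically many phases, all vertices of a tree are deleted. -/
lemma IsTree.alive_eq_empty [Finite V] (hG : G.IsTree) {k N : ℕ} (hN : Nat.card V < 2 ^ N) :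
    G.alive k ((k + 1) * N) = ∅ := by
  rw [Set.eq_empty_iff_forall_notMem]
  intro w hw
  have h1 := hG.two_pow_le_ncard_descendants w hw
  have h2 := Set.ncard_le_card (G.descendants w w)
  omega

end

end

section

variable {V : Type*} {G : SimpleGraph V} {A D : Set V}

/-! ### The coloring defined by the breakers -/

/-- The interval of `q` cyclically consecutive colors that starts at `t * q`. In the order of `t`,
these intervals go around an odd cycle of length `2 * q + 1` in the Kneser graph. -/
def cyclicInterval (q t : ℕ) : Finset (Fin (2 * q + 1)) :=
  (Finset.range q).image fun i => Fin.ofNat (2 * q + 1) (t * q + i)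

lemma card_cyclicInterval (q t : ℕ) : (cyclicInterval q t).card = q := by
  rw [cyclicInterval, Finset.card_image_of_injOn, Finset.card_range]
  intro i hi j hj h
  simp only [Finset.coe_range, Set.mem_Iio] at hi hj
  have h : t * q + i ≡ t * q + j [MOD 2 * q + 1] := congrArg Fin.val h
  exact (Nat.ModEq.add_left_cancel' _ h).eq_of_lt_of_lt (by omega) (by omega)

lemma disjoint_cyclicInterval_succ (q t : ℕ) :
    Disjoint (cyclicInterval q t) (cyclicInterval q (t + 1)) := by
  rw [Finset.disjoint_left]
  intro c hc hc'
  simp only [cyclicInterval, Finset.mem_image, Finset.mem_range] at hc hc'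
  obtain ⟨i, hi, rfl⟩ := hc
  obtain ⟨j, hj, h⟩ := hc'
  have h : (t + 1) * q + j ≡ t * q + i [MOD 2 * q + 1] := congrArg Fin.val h
  rw [add_mul, one_mul, add_assoc] at h
  have := (Nat.ModEq.add_left_cancel' _ h).eq_of_lt_of_lt (by omega) (by omega)
  omega

lemma cyclicInterval_period (q : ℕ) : cyclicInterval q (2 * q + 1) = cyclicInterval q 0 := by
  rw [cyclicInterval, cyclicInterval]
  congr 1
  funext i
  apply Fin.ext
  simp [Fin.ofNat]

/-- The smallest identifier of a vertex that is reached from `v` outside `B` within `L` steps. -/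
noncomputable def leaderIdent (G : SimpleGraph V) (ident : V → ℕ) (B : Set V) (L : ℕ) (v : V) : ℕ :=
  sInf {m | ∃ t ≤ L, ∃ u, G.WalkIn Bᶜ t v u ∧ ident u = m}

/-- The vertex `v` is at odd distance from the vertex of smallest identifier that it reaches
outside `B`. By convention, this is false for the elements of `B`. -/
def OddSide (G : SimpleGraph V) (ident : V → ℕ) (B : Set V) (L : ℕ) (v : V) : Prop :=
  ∃ t ≤ L, Odd t ∧ ∃ u, G.WalkIn Bᶜ t v u ∧ ident u = G.leaderIdent ident B L v

/-- The position of `v` on the odd cycle: its distance from the nearest element of `B` for which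
this distance has the parity prescribed by `OddSide`, except that it is capped at `2 * q` or
`2 * q + 1`, depending on the parity. -/
noncomputable def position (G : SimpleGraph V) (ident : V → ℕ) (B : Set V) (L q : ℕ) (v : V) : ℕ :=
  sInf {t | (Odd t ↔ G.OddSide ident B L v) ∧ (2 * q ≤ t ∨ ∃ u ∈ B, G.WalkIn Set.univ t v u)}

section

variable {ident : V → ℕ} {B : Set V} {L q : ℕ}

lemma position_mem (G : SimpleGraph V) (ident : V → ℕ) (B : Set V) (L q : ℕ) (v : V) :
    (Odd (G.position ident B L q v) ↔ G.OddSide ident B L v) ∧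
      (2 * q ≤ G.position ident B L q v ∨
        ∃ u ∈ B, G.WalkIn Set.univ (G.position ident B L q v) v u) := by
  refine Nat.sInf_mem (s := {t | (Odd t ↔ G.OddSide ident B L v) ∧
    (2 * q ≤ t ∨ ∃ u ∈ B, G.WalkIn Set.univ t v u)}) ?_
  by_cases h : G.OddSide ident B L v
  · exact ⟨2 * q + 1, by simp [h], .inl (by omega)⟩
  · exact ⟨2 * q, by simp [h], .inl le_rfl⟩

lemma position_le {v : V} {t : ℕ} (h : Odd t ↔ G.OddSide ident B L v)
    (h' : 2 * q ≤ t ∨ ∃ u ∈ B, G.WalkIn Set.univ t v u) : G.position ident B L q v ≤ t :=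
  Nat.sInf_le ⟨h, h'⟩

lemma position_of_mem {v : V} (hv : v ∈ B) : G.position ident B L q v = 0 := by
  refine Nat.le_zero.1 (position_le (iff_of_false (by simp) ?_) (.inr ⟨v, hv, trivial, rfl⟩))
  rintro ⟨t, _, _, u, hu, _⟩
  exact hu.left_mem hv

lemma IsTree.even_of_walkIn (hG : G.IsTree) (r : V) {x y : V} {t : ℕ} (h : G.WalkIn A t x y) :
    Even (G.dist r x + G.dist r y + t) := by
  induction t generalizing x with
  | zero =>
    obtain ⟨_, rfl⟩ := h
    exact ⟨G.dist r x, rfl⟩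
  | succ t ih =>
    obtain ⟨_, z, hz, h⟩ := h
    have := ih h
    rw [Nat.even_iff] at this ⊢
    rcases hG.dist_eq_dist_add_one_of_adj r hz with h | h <;> omega

/-- Within a component of the complement of `B`, the sides form a bipartition. -/
lemma IsTree.oddSide_iff_not (hG : G.IsTree) (hinj : Function.Injective ident)
    (hL : ∀ p l, G.NonBacktracking p l → (∀ s ≤ l, p s ∉ B) → l ≤ L) {x y : V}
    (hxy : G.Adj x y) (hx : x ∉ B) (hy : y ∉ B) :
    G.OddSide ident B L x ↔ ¬ G.OddSide ident B L y := by
  have hshort : ∀ {t v u}, G.WalkIn Bᶜ t v u → ∃ t' ≤ L, G.WalkIn Bᶜ t' v u := by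
    intro t v u h
    obtain ⟨p, l, -, hp, rfl, rfl, hpB⟩ := h.exists_nonBacktracking
    exact ⟨l, hL p l hp hpB, hp.walkIn hpB (Nat.zero_le l) le_rfl⟩
  have hset : {m | ∃ t ≤ L, ∃ u, G.WalkIn Bᶜ t x u ∧ ident u = m} =
      {m | ∃ t ≤ L, ∃ u, G.WalkIn Bᶜ t y u ∧ ident u = m} := by
    ext m
    constructor
    · rintro ⟨t, -, u, h, hm⟩
      obtain ⟨t', ht', h'⟩ := hshort (t := t + 1) (v := y) ⟨hy, x, hxy.symm, h⟩
      exact ⟨t', ht', u, h', hm⟩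
    · rintro ⟨t, -, u, h, hm⟩
      obtain ⟨t', ht', h'⟩ := hshort (t := t + 1) (v := x) ⟨hx, y, hxy, h⟩
      exact ⟨t', ht', u, h', hm⟩
  obtain ⟨t, ht, u, hu, hum⟩ : ∃ t ≤ L, ∃ u, G.WalkIn Bᶜ t x u ∧
      ident u = G.leaderIdent ident B L x :=
    Nat.sInf_mem (s := {m | ∃ t ≤ L, ∃ u, G.WalkIn Bᶜ t x u ∧ ident u = m})
      ⟨ident x, 0, Nat.zero_le L, x, ⟨hx, rfl⟩, rfl⟩
  obtain ⟨t', ht', hu'⟩ := hshort (t := t + 1) (v := y) ⟨hy, x, hxy.symm, hu⟩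
  have hum' : ident u = G.leaderIdent ident B L y := by
    rw [hum, leaderIdent, leaderIdent, hset]
  have key : ∀ {v t}, t ≤ L → G.WalkIn Bᶜ t v u → ident u = G.leaderIdent ident B L v →
      (G.OddSide ident B L v ↔ Odd t) := by
    intro v t ht hv hm
    refine ⟨fun ⟨s, hs, hodd, w, hw, hwm⟩ => ?_, fun h => ⟨t, ht, h, u, hv, hm⟩⟩
    obtain rfl := hinj (hwm.trans hm.symm)
    have h1 := hG.even_of_walkIn v hv
    have h2 := hG.even_of_walkIn v hw
    rw [Nat.even_iff] at h1 h2
    rw [Nat.odd_iff] at hodd ⊢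
    omega
  rw [key ht hu hum, key ht' hu' hum']
  have h1 := hG.even_of_walkIn x hu
  have h2 := hG.even_of_walkIn x hu'
  have h3 := dist_eq_one_iff_adj.2 hxy
  rw [Nat.even_iff] at h1 h2
  rw [Nat.odd_iff, Nat.odd_iff]
  rw [dist_self] at h1
  omega

/-- If the elements of `B` are far apart and paths outside `B` are short, then moving along an edge
outside `B` amounts to moving along an edge of the odd cycle. -/
lemma IsTree.position_adj (hG : G.IsTree) (hinj : Function.Injective ident)
    (hL : ∀ p l, G.NonBacktracking p l → (∀ s ≤ l, p s ∉ B) → l ≤ L) {x y : V}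
    (hxy : G.Adj x y) (hx : x ∉ B) (hy : y ∉ B) :
    G.position ident B L q x = G.position ident B L q y + 1 ∨
      G.position ident B L q y = G.position ident B L q x + 1 := by
  have key : ∀ {x y}, G.Adj x y → (G.OddSide ident B L x ↔ ¬ G.OddSide ident B L y) →
      G.position ident B L q x ≤ G.position ident B L q y + 1 := by
    intro x y hxy hodd
    obtain ⟨h1, h2⟩ := G.position_mem ident B L q y
    refine position_le ?_ ?_
    · rw [hodd, ← h1, Nat.odd_add_one]
    · rcases h2 with h2 | ⟨u, hu, h2⟩
      · exact .inl (by omega)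
      · exact .inr ⟨u, hu, trivial, y, hxy, h2⟩
  have hodd := hG.oddSide_iff_not hinj hL hxy hx hy
  have h1 := key hxy hodd
  have h2 := key hxy.symm (hG.oddSide_iff_not hinj hL hxy.symm hy hx)
  have h3 := (G.position_mem ident B L q x).1
  have h4 := (G.position_mem ident B L q y).1
  have h5 : G.position ident B L q x ≠ G.position ident B L q y := by
    intro h
    rw [h, h4] at h3
    tauto
  omega

/-- Next to an element of `B`, which has position `0`, the position is `1` or `2 * q`. -/
lemma IsTree.position_adj_of_mem (hG : G.IsTree)
    (hsep : ∀ p l, G.NonBacktracking p l → l ≤ 2 * q → p 0 ∈ B → p l ∈ B → p 0 = p l) {x y : V}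
    (hxy : G.Adj x y) (hx : x ∈ B) :
    G.position ident B L q y = 1 ∨ G.position ident B L q y = 2 * q := by
  obtain ⟨h1, h2⟩ := G.position_mem ident B L q y
  by_cases hodd : G.OddSide ident B L y
  · left
    refine le_antisymm (position_le (by simp [hodd])
      (.inr ⟨x, hx, trivial, x, hxy.symm, trivial, rfl⟩)) ?_
    exact (h1.2 hodd).pos
  · right
    refine le_antisymm (position_le (by simp [hodd]) (.inl le_rfl)) ?_
    by_contra! hlt
    rcases h2 with h2 | ⟨u, hu, h2⟩
    · omega
    obtain ⟨p, l, hl, hp, hp0, rfl, -⟩ :=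
      WalkIn.exists_nonBacktracking (A := Set.univ) (t := G.position ident B L q y + 1) (x := x)
        ⟨trivial, y, hxy, h2⟩
    have := hsep p l hp (by omega) (hp0 ▸ hx) hu
    rw [← this, hp0] at h2
    have h3 := hG.even_of_walkIn x h2
    rw [dist_self, dist_eq_one_iff_adj.2 hxy] at h3
    rw [← h1, Nat.odd_iff] at hodd
    rw [Nat.even_iff] at h3
    omega

lemma IsTree.isPQColoring_position (hG : G.IsTree) (hinj : Function.Injective ident)
    (hsep : ∀ p l, G.NonBacktracking p l → l ≤ 2 * q → p 0 ∈ B → p l ∈ B → p 0 = p l)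
    (hL : ∀ p l, G.NonBacktracking p l → (∀ s ≤ l, p s ∉ B) → l ≤ L) :
    G.IsPQColoring (2 * q + 1) q fun v => cyclicInterval q (G.position ident B L q v) := by
  refine ⟨fun v => card_cyclicInterval _ _, fun x y hxy => ?_⟩
  have key : ∀ {x y}, G.Adj x y → x ∈ B →
      Disjoint (cyclicInterval q (G.position ident B L q x))
        (cyclicInterval q (G.position ident B L q y)) := by
    intro x y hxy hx
    rw [position_of_mem hx]
    rcases hG.position_adj_of_mem (ident := ident) (L := L) hsep hxy hx with h | h <;> rw [h]
    · exact disjoint_cyclicInterval_succ q 0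
    · rw [← cyclicInterval_period]
      exact (disjoint_cyclicInterval_succ q (2 * q)).symm
  by_cases hx : x ∈ B
  · exact key hxy hx
  by_cases hy : y ∈ B
  · exact (key hxy.symm hy).symm
  dsimp only
  rcases hG.position_adj hinj hL (q := q) hxy hx hy with h | h <;> rw [h]
  · exact (disjoint_cyclicInterval_succ _ _).symm
  · exact disjoint_cyclicInterval_succ _ _

end

end

section

/-! ### Locality -/

/-- The radius-`r` surroundings of `v` and of `v'` look alike to a walker that reads identifiers:
bisimilarity up to depth `r`. -/
def Agree {V V' : Type*} (G : SimpleGraph V) (ident : V → ℕ) (G' : SimpleGraph V')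
    (ident' : V' → ℕ) : ℕ → V → V' → Prop
  | 0, v, v' => ident v = ident' v'
  | r + 1, v, v' => ident v = ident' v' ∧
      (∀ w, G.Adj v w → ∃ w', G'.Adj v' w' ∧ Agree G ident G' ident' r w w') ∧
      (∀ w', G'.Adj v' w' → ∃ w, G.Adj v w ∧ Agree G ident G' ident' r w w')

/-- Membership in `S` and in `S'` is decided in the same way by the radius-`r` surroundings of a
vertex. -/
def AgreeOn {V V' : Type*} (G : SimpleGraph V) (ident : V → ℕ) (G' : SimpleGraph V')
    (ident' : V' → ℕ) (r : ℕ) (S : Set V) (S' : Set V') : Prop :=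
  ∀ v v', G.Agree ident G' ident' r v v' → (v ∈ S ↔ v' ∈ S')

section

variable {V V' : Type*} {G : SimpleGraph V} {G' : SimpleGraph V'} {ident : V → ℕ}
  {ident' : V' → ℕ} {A D : Set V} {A' D' : Set V'} {r s t k : ℕ}

lemma Agree.ident_eq {v : V} {v' : V'} (h : G.Agree ident G' ident' r v v') :
    ident v = ident' v' := by
  cases r
  · exact h
  · exact h.1

lemma Agree.symm {v : V} {v' : V'} (h : G.Agree ident G' ident' r v v') :
    G'.Agree ident' G ident r v' v := by
  induction r generalizing v v' with
  | zero => exact Eq.symm h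
  | succ r ih =>
    refine ⟨h.1.symm, fun w' hw' => ?_, fun w hw => ?_⟩
    · obtain ⟨w, hw, hww⟩ := h.2.2 w' hw'
      exact ⟨w, hw, ih hww⟩
    · obtain ⟨w', hw', hww⟩ := h.2.1 w hw
      exact ⟨w', hw', ih hww⟩

lemma Agree.mono {v : V} {v' : V'} (hrs : r ≤ s) (h : G.Agree ident G' ident' s v v') :
    G.Agree ident G' ident' r v v' := by
  induction s generalizing r v v' with
  | zero =>
    obtain rfl : r = 0 := by omega
    exact h
  | succ s ih =>
    cases r with
    | zero => exact h.1
    | succ r =>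
      refine ⟨h.1, fun w hw => ?_, fun w' hw' => ?_⟩
      · obtain ⟨w', hw', hww⟩ := h.2.1 w hw
        exact ⟨w', hw', ih (by omega) hww⟩
      · obtain ⟨w, hw, hww⟩ := h.2.2 w' hw'
        exact ⟨w, hw, ih (by omega) hww⟩

lemma AgreeOn.symm (h : G.AgreeOn ident G' ident' r A A') : G'.AgreeOn ident' G ident r A' A :=
  fun v' v hv => (h v v' hv.symm).symm

lemma AgreeOn.mono (hrs : r ≤ s) (h : G.AgreeOn ident G' ident' r A A') :
    G.AgreeOn ident G' ident' s A A' :=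
  fun v v' hv => h v v' (hv.mono hrs)

lemma AgreeOn.of_imp {S : Set V} {S' : Set V'}
    (h : ∀ v v', G.Agree ident G' ident' r v v' → v ∈ S → v' ∈ S')
    (h' : ∀ v' v, G'.Agree ident' G ident r v' v → v' ∈ S' → v ∈ S) :
    G.AgreeOn ident G' ident' r S S' :=
  fun v v' hv => ⟨h v v' hv, h' v' v hv.symm⟩

lemma AgreeOn.compl (h : G.AgreeOn ident G' ident' r A A') :
    G.AgreeOn ident G' ident' r Aᶜ A'ᶜ :=
  fun v v' hv => not_congr (h v v' hv)

lemma AgreeOn.univ : G.AgreeOn ident G' ident' r Set.univ Set.univ := fun _ _ _ => Iff.rfl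

lemma AgreeOn.diff (hA : G.AgreeOn ident G' ident' r A A')
    (hD : G.AgreeOn ident G' ident' r D D') :
    G.AgreeOn ident G' ident' r (A \ D) (A' \ D') :=
  fun v v' hv => and_congr (hA v v' hv) (not_congr (hD v v' hv))

lemma AgreeOn.exists_adj (hA : G.AgreeOn ident G' ident' r A A') {x y : V} {x' : V'}
    (hx : G.Agree ident G' ident' (r + 1) x x') (hy : y ∈ A ∧ G.Adj x y) :
    ∃ y', (y' ∈ A' ∧ G'.Adj x' y') ∧ ident' y' = ident y := by
  obtain ⟨y', hy', h⟩ := hx.2.1 y hy.2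
  exact ⟨y', ⟨(hA y y' h).1 hy.1, hy'⟩, h.ident_eq.symm⟩

lemma AgreeOn.exists_walkIn (hA : G.AgreeOn ident G' ident' r A A') (hrs : r ≤ s) {x y : V}
    {x' : V'} (hx : G.Agree ident G' ident' (s + t) x x') (h : G.WalkIn A t x y) :
    ∃ y', G'.WalkIn A' t x' y' ∧ G.Agree ident G' ident' s y y' := by
  induction t generalizing x x' with
  | zero =>
    obtain ⟨hxA, rfl⟩ := h
    exact ⟨x', ⟨(hA x x' (hx.mono hrs)).1 hxA, rfl⟩, hx⟩
  | succ t ih =>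
    obtain ⟨hxA, z, hz, h⟩ := h
    obtain ⟨z', hz', hzz⟩ := hx.2.1 z hz
    obtain ⟨y', hy', hyy⟩ := ih hzz h
    exact ⟨y', ⟨(hA x x' (hx.mono (by omega))).1 hxA, z', hz', hy'⟩, hyy⟩

lemma AgreeOn.hasTwo (hinj : Function.Injective ident)
    (hA : G.AgreeOn ident G' ident' r A A') {x : V} {x' : V'}
    (hx : G.Agree ident G' ident' (r + 1) x x') (h : G.HasTwo A x) : G'.HasTwo A' x' := by
  obtain ⟨y, z, hne, hy, hz⟩ := h
  obtain ⟨y', hy', hyy⟩ := hA.exists_adj hx hy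
  obtain ⟨z', hz', hzz⟩ := hA.exists_adj hx hz
  exact ⟨y', z', by rintro rfl; exact hne (hinj (hyy.symm.trans hzz)), hy', hz'⟩

lemma AgreeOn.hasThree (hinj : Function.Injective ident)
    (hA : G.AgreeOn ident G' ident' r A A') {x : V} {x' : V'}
    (hx : G.Agree ident G' ident' (r + 1) x x') (h : G.HasThree A x) : G'.HasThree A' x' := by
  obtain ⟨y, z, w, ⟨h1, h2, h3⟩, hy, hz, hw⟩ := h
  obtain ⟨y', hy', hyy⟩ := hA.exists_adj hx hy
  obtain ⟨z', hz', hzz⟩ := hA.exists_adj hx hz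
  obtain ⟨w', hw', hww⟩ := hA.exists_adj hx hw
  exact ⟨y', z', w', ⟨by rintro rfl; exact h1 (hinj (hyy.symm.trans hzz)),
    by rintro rfl; exact h2 (hinj (hyy.symm.trans hww)),
    by rintro rfl; exact h3 (hinj (hzz.symm.trans hww))⟩, hy', hz', hw'⟩

lemma AgreeOn.rake (hinj : Function.Injective ident) (hinj' : Function.Injective ident')
    (hA : G.AgreeOn ident G' ident' r A A') :
    G.AgreeOn ident G' ident' (r + 1) (G.rake A) (G'.rake A') :=
  .of_imp (fun v v' hv h => ⟨(hA v v' (hv.mono (by omega))).1 h.1, hA.hasTwo hinj hv h.2⟩)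
    (fun v v' hv h =>
      ⟨(hA.symm v v' (hv.mono (by omega))).1 h.1, hA.symm.hasTwo hinj' hv h.2⟩)

lemma AgreeOn.mem_deep (hinj' : Function.Injective ident')
    (hA : G.AgreeOn ident G' ident' r A A') {x : V} {x' : V'}
    (hx : G.Agree ident G' ident' (r + (k + 1)) x x') (h : x ∈ G.deep k A) :
    x' ∈ G'.deep k A' := by
  refine ⟨(hA x x' (hx.mono (by omega))).1 h.1, fun t ht y' hy' h3 => ?_⟩
  obtain ⟨y, hy, hyy⟩ := hA.symm.exists_walkIn (s := r + 1) (by omega)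
    (hx.symm.mono (by omega)) hy'
  exact h.2 t ht y hy (hA.symm.hasThree hinj' hyy h3)

lemma AgreeOn.deep (hinj : Function.Injective ident) (hinj' : Function.Injective ident')
    (hA : G.AgreeOn ident G' ident' r A A') :
    G.AgreeOn ident G' ident' (r + (k + 1)) (G.deep k A) (G'.deep k A') :=
  .of_imp (fun _ _ => hA.mem_deep hinj') (fun _ _ => hA.symm.mem_deep hinj)

lemma AgreeOn.alive (hinj : Function.Injective ident) (hinj' : Function.Injective ident') (i : ℕ) :
    G.AgreeOn ident G' ident' (phaseRadius k i) (G.alive k i) (G'.alive k i) := by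
  induction i with
  | zero => exact .univ
  | succ i ih =>
    rw [SimpleGraph.alive, SimpleGraph.alive, phaseRadius]
    split_ifs
    · exact (ih.mono (by omega)).diff (ih.deep hinj hinj')
    · exact ih.rake hinj hinj'

lemma AgreeOn.boundaryIn (hA : G.AgreeOn ident G' ident' r A A')
    (hD : G.AgreeOn ident G' ident' r D D') :
    G.AgreeOn ident G' ident' (r + 1) (G.boundaryIn A D) (G'.boundaryIn A' D') := by
  refine .of_imp (fun v v' hv ⟨h, y, hy⟩ => ?_) (fun v v' hv ⟨h, y, hy⟩ => ?_)
  · obtain ⟨y', hy', -⟩ := (hA.diff hD).exists_adj hv hy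
    exact ⟨(hD v v' (hv.mono (by omega))).1 h, y', hy'⟩
  · obtain ⟨y', hy', -⟩ := (hA.diff hD).symm.exists_adj hv hy
    exact ⟨(hD.symm v v' (hv.mono (by omega))).1 h, y', hy'⟩

lemma AgreeOn.near (hD : G.AgreeOn ident G' ident' r D D') (hrs : r ≤ s) {x y : V} {x' : V'}
    (hx : G.Agree ident G' ident' (s + k) x x') (h : G.Near k D x y) :
    ∃ y', G'.Near k D' x' y' ∧ G.Agree ident G' ident' s y y' := by
  obtain ⟨t, ht, h⟩ := h
  obtain ⟨y', hy', hyy⟩ := hD.exists_walkIn hrs (hx.mono (by omega)) h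
  exact ⟨y', ⟨t, ht, hy'⟩, hyy⟩

lemma AgreeOn.ruling {key : V → ℕ} {key' : V' → ℕ} (hD : G.AgreeOn ident G' ident' r D D')
    (hkey : ∀ v v', G.Agree ident G' ident' r v v' → key v = key' v') (i : ℕ) :
    G.AgreeOn ident G' ident' (r + k * i) (ruling key (G.Near k D) D i)
      (ruling key' (G'.Near k D') D' i) := by
  induction i with
  | zero => exact hD
  | succ i ih =>
    rw [Nat.mul_succ, ← add_assoc]
    have hle : r ≤ r + k * i := Nat.le_add_right _ _
    refine .of_imp (fun v v' hv h => ?_) (fun v' v hv h => ?_)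
    · refine ⟨(ih v v' (hv.mono (by omega))).1 h.1, fun y' hy' hR heq => ?_⟩
      obtain ⟨y, hy, hyy⟩ := hD.symm.near hle hv.symm hR
      have hkv := hkey v v' (hv.mono (by omega))
      have hky := hkey y y' (hyy.symm.mono hle)
      have := h.2 y ((ih y y' hyy.symm).2 hy') hy
      rw [hkv, hky] at this
      exact this heq
    · refine ⟨(ih v v' (hv.symm.mono (by omega))).2 h.1, fun y hy hR heq => ?_⟩
      obtain ⟨y', hy', hyy⟩ := hD.near hle hv.symm hR
      have hkv := hkey v v' (hv.symm.mono (by omega))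
      have hky := hkey y y' (hyy.mono hle)
      have := h.2 y' ((ih y y' hyy).1 hy) hy'
      rw [← hkv, ← hky] at this
      exact this heq

lemma AgreeOn.priorityKey_eq {b : ℕ} (hA : G.AgreeOn ident G' ident' r A A') {v : V} {v' : V'}
    (hv : G.Agree ident G' ident' r v v') :
    priorityKey ident b A v = priorityKey ident' b A' v' := by
  classical
  rw [priorityKey, priorityKey, hv.ident_eq]
  exact congrArg _ (if_congr (hA v v' hv) rfl rfl)

lemma AgreeOn.breakersIn {b : ℕ} (hinj : Function.Injective ident)
    (hinj' : Function.Injective ident') (hA : G.AgreeOn ident G' ident' r A A') :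
    G.AgreeOn ident G' ident' (r + (k + 2) + k * (b + 1)) (G.breakersIn ident k b A)
      (G'.breakersIn ident' k b A') := by
  have hD := hA.deep (k := k) hinj hinj'
  have hbd := (hA.mono (s := r + (k + 1)) (by omega)).boundaryIn hD
  exact (hD.mono (s := r + (k + 2)) (by omega)).ruling (fun v v' hv => hbd.priorityKey_eq hv) _

/-- The radius of the surroundings of a vertex that decide whether it is a breaker. -/
def breakerRadius (k b N : ℕ) : ℕ := phaseRadius k ((k + 1) * N) + (k + 2) + k * (b + 1)

lemma AgreeOn.breakers {b N : ℕ} (hinj : Function.Injective ident)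
    (hinj' : Function.Injective ident') :
    G.AgreeOn ident G' ident' (breakerRadius k b N) (G.breakers ident k b N)
      (G'.breakers ident' k b N) := by
  intro v v' hv
  refine exists_congr fun j => and_congr_right fun hj => ?_
  have hle : phaseRadius k ((k + 1) * j) ≤ phaseRadius k ((k + 1) * N) :=
    phaseRadius_mono k (Nat.mul_le_mul_left _ hj.le)
  exact (AgreeOn.alive hinj hinj' _).breakersIn hinj hinj' v v'
    (hv.mono (by rw [breakerRadius]; omega))

variable {B : Set V} {B' : Set V'} {L q : ℕ} {v : V} {v' : V'}

lemma AgreeOn.leaderIdent_eq (hB : G.AgreeOn ident G' ident' r B B')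
    (hv : G.Agree ident G' ident' (r + L) v v') :
    G.leaderIdent ident B L v = G'.leaderIdent ident' B' L v' := by
  rw [leaderIdent, leaderIdent]
  congr 1
  ext m
  refine exists_congr fun t => and_congr_right fun ht => ⟨?_, ?_⟩
  · rintro ⟨u, hu, rfl⟩
    obtain ⟨u', hu', huu⟩ := hB.compl.exists_walkIn le_rfl (hv.mono (by omega)) hu
    exact ⟨u', hu', huu.ident_eq.symm⟩
  · rintro ⟨u', hu', rfl⟩
    obtain ⟨u, hu, huu⟩ := hB.compl.symm.exists_walkIn le_rfl (hv.symm.mono (by omega)) hu'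
    exact ⟨u, hu, huu.ident_eq.symm⟩

lemma AgreeOn.oddSide (hB : G.AgreeOn ident G' ident' r B B')
    (hv : G.Agree ident G' ident' (r + L) v v') (h : G.OddSide ident B L v) :
    G'.OddSide ident' B' L v' := by
  obtain ⟨t, ht, hodd, u, hu, hm⟩ := h
  obtain ⟨u', hu', huu⟩ := hB.compl.exists_walkIn le_rfl (hv.mono (by omega)) hu
  exact ⟨t, ht, hodd, u', hu', by rw [← huu.ident_eq, hm, hB.leaderIdent_eq hv]⟩

lemma AgreeOn.position_le (hB : G.AgreeOn ident G' ident' r B B')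
    (hv : G.Agree ident G' ident' (r + L + 2 * q) v v') :
    G'.position ident' B' L q v' ≤ G.position ident B L q v := by
  obtain ⟨h1, h2⟩ := G.position_mem ident B L q v
  have hv' := hv.mono (r := r + L) (by omega)
  refine SimpleGraph.position_le
    (h1.trans ⟨hB.oddSide hv', hB.symm.oddSide hv'.symm⟩) ?_
  by_cases hle : 2 * q ≤ G.position ident B L q v
  · exact .inl hle
  · obtain ⟨u, hu, hw⟩ := h2.resolve_left hle
    obtain ⟨u', hu', huu⟩ := AgreeOn.univ.exists_walkIn (G' := G') (Nat.zero_le r)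
      (hv.mono (by omega)) hw
    exact .inr ⟨u', (hB u u' huu).1 hu, hu'⟩

lemma AgreeOn.position_eq (hB : G.AgreeOn ident G' ident' r B B')
    (hv : G.Agree ident G' ident' (r + L + 2 * q) v v') :
    G.position ident B L q v = G'.position ident' B' L q v' :=
  le_antisymm (hB.symm.position_le hv.symm) (hB.position_le hv)

end

/-- The graph on the identifiers that a vertex sees, with all other integers as isolated
vertices. -/
def _root_.LocalView.graph (w : LocalView) : SimpleGraph ℕ := fromRel w.Adj

/-- A local view of radius `R` shows the radius-`R` surroundings of its root. -/
lemma agree_localView {V : Type*} {G : SimpleGraph V} {ident : V → ℕ}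
    (hinj : Function.Injective ident) {R : ℕ} {c v : V} {r : ℕ} (h : G.edist c v + r ≤ R) :
    G.Agree ident (G.localView ident R c).graph id r v (ident v) := by
  induction r generalizing v with
  | zero => rfl
  | succ r ih =>
    have hv : G.edist c v ≤ R := le_trans le_self_add h
    have hstep : ∀ w, G.Adj v w → G.edist c w + r ≤ R := by
      intro w hw
      refine le_trans ?_ h
      have : G.edist c w ≤ G.edist c v + 1 := by
        rw [← edist_eq_one_iff_adj.2 hw]
        exact G.edist_triangle
      rw [Nat.cast_succ, add_comm (r : ℕ∞) 1, ← add_assoc]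
      exact add_le_add_left this _
    have hmem : ∀ w, G.Adj v w → G.edist c w ≤ R := fun w hw => le_trans le_self_add (hstep w hw)
    refine ⟨rfl, fun w hw => ⟨ident w, ?_, ih (hstep w hw)⟩, fun w' hw' => ?_⟩
    · rw [LocalView.graph, fromRel_adj]
      exact ⟨hinj.ne hw.ne, .inl ⟨v, w, hv, hmem w hw, hw, rfl, rfl⟩⟩
    · rw [LocalView.graph, fromRel_adj] at hw'
      rcases hw'.2 with ⟨u, w, -, -, huw, hu, rfl⟩ | ⟨w, u, -, -, huw, rfl, hu⟩
      · obtain rfl := hinj hu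
        exact ⟨w, huw, ih (hstep w huw)⟩
      · obtain rfl := hinj hu
        exact ⟨w, huw.symm, ih (hstep w huw.symm)⟩

end

section

/-! ### The algorithm -/

/-- A bound for the length of paths without breakers. -/
def breakerGap (k b N : ℕ) : ℕ := 2 * phaseRadius k ((k + 1) * N) + 2 * (k * (b + 1)) + 1

/-- The radius of the surroundings of a vertex that decide its color. -/
def colorRadius (q b N : ℕ) : ℕ := breakerRadius (2 * q) b N + breakerGap (2 * q) b N + 2 * q

/-- Color a vertex by its position relative to the breakers, both computed in the graph that it
sees. On `n`-vertex trees, `Nat.log 2 n + 1` phases suffice, and identifiers up to `n ^ m` have at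
most `m * (Nat.log 2 n + 1)` binary digits. -/
noncomputable def breakerAlgorithm (m q : ℕ) : LocalAlgorithm (Finset (Fin (2 * q + 1))) where
  rounds n := colorRadius q (m * (Nat.log 2 n + 1)) (Nat.log 2 n + 1)
  output n w :=
    let N := Nat.log 2 n + 1
    let b := m * N
    cyclicInterval q (w.graph.position id (w.graph.breakers id (2 * q) b N)
      (breakerGap (2 * q) b N) q w.root)

lemma breakerAlgorithm_colorsTrees {c : ℝ} (hc : 1 ≤ c) (q : ℕ) {n : ℕ} (hn : 1 ≤ n) :
    (breakerAlgorithm ⌈c⌉₊ q).ColorsTrees q c n := by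
  rintro G ident hG ⟨hinj, hid⟩
  set m := ⌈c⌉₊
  set N := Nat.log 2 n + 1
  set b := m * N
  have hlt : n < 2 ^ N := Nat.lt_pow_succ_log_self one_lt_two n
  have hm : m ≠ 0 := by
    have : (1 : ℝ) ≤ m := hc.trans (Nat.le_ceil c)
    rintro h
    rw [h] at this
    norm_num at this
  have hb : ∀ x, ident x < 2 ^ b := by
    intro x
    have h1 : (ident x : ℝ) ≤ (n : ℝ) ^ m := by
      refine (hid x).2.trans ?_
      rw [← Real.rpow_natCast]
      exact Real.rpow_le_rpow_of_exponent_le (by exact_mod_cast hn) (Nat.le_ceil c)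
    have h2 : ident x ≤ n ^ m := by exact_mod_cast h1
    calc ident x ≤ n ^ m := h2
      _ < (2 ^ N) ^ m := Nat.pow_lt_pow_left hlt hm
      _ = 2 ^ b := by rw [← pow_mul, mul_comm]
  have hempty : G.alive (2 * q) ((2 * q + 1) * N) = ∅ :=
    hG.alive_eq_empty (by simpa using hlt)
  have hcol := hG.isPQColoring_position hinj (q := q) (B := G.breakers ident (2 * q) b N)
    (L := breakerGap (2 * q) b N)
    (fun p l hp hl h0 h1 => eq_of_mem_breakers hinj hb hp hl h0 h1)
    (fun p l hp hB => length_le_of_avoids hb hempty hp hB)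
  have hrun : (breakerAlgorithm m q).run G ident = fun v => cyclicInterval q
      (G.position ident (G.breakers ident (2 * q) b N) (breakerGap (2 * q) b N) q v) := by
    funext v
    have hagree := agree_localView (G := G) hinj (R := colorRadius q b N) (c := v) (v := v)
      (r := colorRadius q b N) (by simp)
    exact congrArg (cyclicInterval q) ((AgreeOn.breakers hinj Function.injective_id).position_eq hagree).symm
  rw [hrun]
  exact hcol

lemma colorRadius_le {m q N : ℕ} (hq : 1 ≤ q) (hN : 1 ≤ N) :
    colorRadius q (m * N) N ≤ (28 + 6 * m) * (q * N) := by
  have hdiv : ((2 * q + 1) * N + 2 * q) / (2 * q + 1) = N := by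
    rw [Nat.mul_add_div (by omega), Nat.div_eq_of_lt (by omega), add_zero]
  have h := phaseRadius_le (2 * q) ((2 * q + 1) * N)
  rw [hdiv] at h
  rw [colorRadius, breakerRadius, breakerGap]
  have h1 : N ≤ q * N := Nat.le_mul_of_pos_left N hq
  have h2 : q ≤ q * N := Nat.le_mul_of_pos_right q hN
  have h3 : (2 * q + 1) * N + 2 * q * N = 4 * (q * N) + N := by ring
  have h4 : 2 * q * (m * N + 1) = 2 * (m * (q * N)) + 2 * q := by ring
  have h5 : (28 + 6 * m) * (q * N) = 28 * (q * N) + 6 * (m * (q * N)) := by ring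
  rw [h4, h5]
  omega

theorem exists_localAlgorithm {c : ℝ} (hc : 1 ≤ c) : ∃ C : ℝ, 0 < C ∧ ∀ q : ℕ, 1 ≤ q →
    ∃ A : LocalAlgorithm (Finset (Fin (2 * q + 1))), ∀ n : ℕ, 1 ≤ n →
      (A.rounds n : ℝ) ≤ C * (q * Real.log n + (q : ℝ) ^ 2) ∧ A.ColorsTrees q c n := by
  refine ⟨2 * (28 + 6 * ⌈c⌉₊), by positivity, fun q hq => ⟨breakerAlgorithm ⌈c⌉₊ q,
    fun n hn => ⟨?_, breakerAlgorithm_colorsTrees hc q hn⟩⟩⟩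
  have h1 : ((breakerAlgorithm ⌈c⌉₊ q).rounds n : ℝ) ≤
      (28 + 6 * ⌈c⌉₊) * (q * ((Nat.log 2 n : ℝ) + 1)) := by
    exact_mod_cast colorRadius_le (m := ⌈c⌉₊) hq (Nat.succ_pos (Nat.log 2 n))
  have h2 : (Nat.log 2 n : ℝ) ≤ 2 * Real.log n := by
    have hpow : ((2 : ℝ) ^ Nat.log 2 n) ≤ n := by exact_mod_cast Nat.pow_log_le_self 2 (by omega)
    have h := Real.log_le_log (by positivity) hpow
    rw [Real.log_pow] at h
    have := Real.log_two_gt_d9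
    have h0 : (0 : ℝ) ≤ Nat.log 2 n := Nat.cast_nonneg _
    nlinarith
  have hq' : (1 : ℝ) ≤ q := by exact_mod_cast hq
  have h3 : (q : ℝ) * ((Nat.log 2 n : ℝ) + 1) ≤ 2 * (q * Real.log n + (q : ℝ) ^ 2) := by
    nlinarith
  calc ((breakerAlgorithm ⌈c⌉₊ q).rounds n : ℝ)
      ≤ (28 + 6 * ⌈c⌉₊) * (q * ((Nat.log 2 n : ℝ) + 1)) := h1
    _ ≤ (28 + 6 * ⌈c⌉₊) * (2 * (q * Real.log n + (q : ℝ) ^ 2)) :=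
        mul_le_mul_of_nonneg_left h3 (by positivity)
    _ = 2 * (28 + 6 * ⌈c⌉₊) * (q * Real.log n + (q : ℝ) ^ 2) := by ring

end

section

/-! ### Graphs without short cycles and without large independent sets -/

variable {V : Type*} {G : SimpleGraph V}

/-- Every detour that avoids an edge between its ends has length at least `g`: the graph has no
cycle of length at most `g`. -/
def NoShortDetour (G : SimpleGraph V) (g : ℕ) : Prop :=
  ∀ ⦃x y : V⦄, G.Adj x y → ∀ w : G.Walk x y, s(x, y) ∉ w.edges → g ≤ w.length

/-- A walk in the graph with an additional edge `s(a, b)` can be shortened to one that does not use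
this edge or uses it only once. -/
lemma exists_walk_of_walk_sup_edge {a b x y : V} (w : (G ⊔ edge a b).Walk x y) :
    (∃ w' : G.Walk x y, w'.length ≤ w.length ∧ w'.edges ⊆ w.edges) ∨
    (∃ (p : G.Walk x a) (r : G.Walk b y), p.length + r.length + 1 ≤ w.length ∧
      r.edges ⊆ w.edges) ∨
    (∃ (p : G.Walk x b) (r : G.Walk a y), p.length + r.length + 1 ≤ w.length ∧
      r.edges ⊆ w.edges) := by
  induction w with
  | nil => exact .inl ⟨.nil, le_rfl, by simp⟩
  | @cons x z y h w ih =>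
    simp only [Walk.length_cons, Walk.edges_cons]
    have hsub : ∀ {l : List (Sym2 V)}, l ⊆ w.edges → l ⊆ s(x, z) :: w.edges :=
      fun h => List.subset_cons_of_subset _ h
    rcases h with h | h
    · rcases ih with ⟨w', h1, h2⟩ | ⟨p, r, h1, h2⟩ | ⟨p, r, h1, h2⟩
      · exact .inl ⟨.cons h w', by simpa using h1, by simpa using hsub h2⟩
      · exact .inr (.inl ⟨.cons h p, r, by simp; omega, hsub h2⟩)
      · exact .inr (.inr ⟨.cons h p, r, by simp; omega, hsub h2⟩)
    · rw [edge_adj] at h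
      rcases h with ⟨⟨rfl, rfl⟩ | ⟨rfl, rfl⟩, -⟩
      · rcases ih with ⟨w', h1, h2⟩ | ⟨p, r, h1, h2⟩ | ⟨p, r, h1, h2⟩
        · exact .inr (.inl ⟨.nil, w', by simp; omega, hsub h2⟩)
        · exact .inr (.inl ⟨.nil, r, by simp; omega, hsub h2⟩)
        · exact .inl ⟨r, by omega, hsub h2⟩
      · rcases ih with ⟨w', h1, h2⟩ | ⟨p, r, h1, h2⟩ | ⟨p, r, h1, h2⟩
        · exact .inr (.inr ⟨.nil, w', by simp; omega, hsub h2⟩)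
        · exact .inl ⟨r, by omega, hsub h2⟩
        · exact .inr (.inr ⟨.nil, r, by simp; omega, hsub h2⟩)

/-- Joining two vertices at distance at least `g` creates no short cycle. -/
lemma NoShortDetour.sup_edge {g : ℕ} (hG : G.NoShortDetour g) {a b : V}
    (hab : ∀ w : G.Walk a b, g ≤ w.length) : (G ⊔ edge a b).NoShortDetour g := by
  have hnew : ∀ {x y} (w : (G ⊔ edge a b).Walk x y), s(a, b) ∉ w.edges →
      ∃ w' : G.Walk x y, w'.length = w.length := by
    intro x y w hw
    refine ⟨w.transfer G fun e he => ?_, Walk.length_transfer _ _⟩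
    have := w.edges_subset_edgeSet he
    induction e with | _ u v =>
    rw [mem_edgeSet, sup_adj, edge_adj] at this
    rcases this with h | ⟨⟨rfl, rfl⟩ | ⟨rfl, rfl⟩, -⟩
    · exact h
    · exact absurd he hw
    · exact absurd he (by rwa [Sym2.eq_swap])
  intro x y hxy w hw
  rw [sup_adj, edge_adj] at hxy
  rcases hxy with hxy | ⟨⟨rfl, rfl⟩ | ⟨rfl, rfl⟩, -⟩
  · rcases exists_walk_of_walk_sup_edge w with ⟨w', h1, h2⟩ | ⟨p, r, h1, -⟩ | ⟨p, r, h1, -⟩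
    · exact (hG hxy w' fun h => hw (h2 h)).trans h1
    · have := hab (p.reverse.append (.cons hxy r.reverse))
      simp only [Walk.length_append, Walk.length_cons, Walk.length_reverse] at this
      omega
    · have := hab (r.append (.cons hxy.symm p))
      simp only [Walk.length_append, Walk.length_cons] at this
      omega
  · obtain ⟨w', hw'⟩ := hnew w hw
    exact hw' ▸ hab w'
  · obtain ⟨w', hw'⟩ := hnew w (by rwa [Sym2.eq_swap])
    simpa [hw'] using hab w'.reverse

/-- Joining different components creates no cycle at all. -/
lemma NoShortDetour.exists_connected [Finite V] [Nonempty V] {g : ℕ} (hG : G.NoShortDetour g) :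
    ∃ G', G ≤ G' ∧ G'.NoShortDetour g ∧ G'.Connected := by
  obtain ⟨G', hle, hmax⟩ := Set.Finite.exists_le_maximal (s := {H : SimpleGraph V |
    H.NoShortDetour g}) (Set.toFinite _) (a := G) hG
  refine ⟨G', hle, hmax.prop, ⟨fun a b => ?_⟩⟩
  by_contra h
  have h1 := hmax.prop.sup_edge (a := a) (b := b) fun w => absurd ⟨w⟩ h
  have h2 : G' ⊔ edge a b ≤ G' := hmax.le_of_ge h1 le_sup_left
  have hne : a ≠ b := by
    rintro rfl
    exact h (Reachable.refl _)
  have h3 : G'.Adj a b := h2 (show (G' ⊔ edge a b).Adj a b by simp [edge_adj, hne])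
  exact h h3.reachable

section

open Classical

variable [Fintype V]

/-- The vertices that are reached from `a` by walks of length less than `g`. -/
noncomputable def openBall (G : SimpleGraph V) (g : ℕ) (a : V) : Finset V :=
  Finset.univ.filter fun b => ∃ w : G.Walk a b, w.length < g

lemma card_openBall_le {d : ℕ} (hd : ∀ v, G.degree v ≤ d) (g : ℕ) (a : V) :
    (G.openBall g a).card ≤ (d + 1) ^ g := by
  induction g generalizing a with
  | zero => simp [openBall]
  | succ g ih =>
    have hsub : G.openBall (g + 1) a ⊆
        {a} ∪ (G.neighborFinset a).biUnion (G.openBall g) := by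
      intro b hb
      simp only [openBall, Finset.mem_filter, Finset.mem_univ, true_and] at hb
      obtain ⟨w, hw⟩ := hb
      rcases w with _ | ⟨h, w⟩
      · simp
      · rename_i c
        simp only [Walk.length_cons] at hw
        refine Finset.mem_union_right _ (Finset.mem_biUnion.2 ⟨c, by simpa using h, ?_⟩)
        simp only [openBall, Finset.mem_filter, Finset.mem_univ, true_and]
        exact ⟨w, by omega⟩
    calc (G.openBall (g + 1) a).card
        ≤ 1 + G.degree a * (d + 1) ^ g :=
          (Finset.card_le_card hsub).trans ((Finset.card_union_le _ _).trans
            (add_le_add (by simp) (Finset.card_biUnion_le_card_mul _ _ _ fun c _ => ih c)))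
      _ ≤ (d + 1) ^ g + d * (d + 1) ^ g :=
          add_le_add (Nat.one_le_pow _ _ (Nat.succ_pos d)) (Nat.mul_le_mul_right _ (hd a))
      _ = (d + 1) ^ (g + 1) := by ring

lemma degree_le_of_le_sup_edge {H : SimpleGraph V} {a b : V} (hH : H ≤ G ⊔ edge a b) (v : V) :
    H.degree v ≤ G.degree v + ((if v = a then 1 else 0) + if v = b then 1 else 0) := by
  have hsub : H.neighborFinset v ⊆ G.neighborFinset v ∪
      ((if v = a then {b} else ∅) ∪ if v = b then {a} else ∅) := by
    intro w hw
    have hw' := hH ((mem_neighborFinset _ _ _).1 hw)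
    rw [sup_adj, edge_adj] at hw'
    rcases hw' with h | ⟨⟨rfl, rfl⟩ | ⟨rfl, rfl⟩, -⟩
    · exact Finset.mem_union_left _ (by simpa using h)
    · simp
    · simp
  refine (Finset.card_le_card hsub).trans ((Finset.card_union_le _ _).trans
    (add_le_add le_rfl ((Finset.card_union_le _ _).trans (add_le_add ?_ ?_)))) <;>
  split_ifs <;> simp

/-- The independent sets that contain at least a quarter of the vertices. -/
noncomputable def largeIndepSets (G : SimpleGraph V) : Finset (Finset V) :=
  Finset.univ.filter fun S => Fintype.card V ≤ 4 * S.card ∧ ∀ a ∈ S, ∀ b ∈ S, ¬ G.Adj a b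

/-- One step of a greedy construction. As few vertices have degree `d` and few pairs are close,
a positive proportion of the pairs of vertices in a large set can be joined. On average, therefore,
an admissible new edge destroys a positive proportion of the large independent sets. -/
lemma exists_sup_edge [Nonempty V] {g d : ℕ} (hg : 1 ≤ g) (hG : G.NoShortDetour g)
    (hd : ∀ v, G.degree v ≤ d)
    (hsum : 8 * ∑ v, G.degree v ≤ d * Fintype.card V) (hd0 : 0 < d)
    (hV : 200 * (d + 1) ^ g ≤ Fintype.card V) :
    ∃ G' : SimpleGraph V, G'.NoShortDetour g ∧ (∀ v, G'.degree v ≤ d) ∧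
      ∑ v, G'.degree v ≤ ∑ v, G.degree v + 2 ∧
      100 * G'.largeIndepSets.card ≤ 99 * G.largeIndepSets.card := by
  set n := Fintype.card V with hn
  set U := G.largeIndepSets with hU
  set full : Finset V := Finset.univ.filter fun v => G.degree v = d with hfull
  set P : Finset (V × V) := Finset.univ.filter fun p =>
    G.degree p.1 ≠ d ∧ G.degree p.2 ≠ d ∧ p.2 ∉ G.openBall g p.1 with hP
  have hn0 : 0 < n := Fintype.card_pos
  have hfull_card : 8 * full.card ≤ n := by
    have h1 : full.card * d ≤ ∑ v, G.degree v :=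
      calc full.card * d = ∑ v ∈ full, G.degree v := by
            rw [Finset.sum_congr rfl fun v hv => (Finset.mem_filter.1 hv).2, Finset.sum_const,
              smul_eq_mul]
        _ ≤ ∑ v, G.degree v := Finset.sum_le_sum_of_subset (Finset.subset_univ _)
    have h2 : d * (8 * full.card) ≤ d * n := by
      calc d * (8 * full.card) = 8 * (full.card * d) := by ring
        _ ≤ 8 * ∑ v, G.degree v := by omega
        _ ≤ d * n := hsum
    exact Nat.le_of_mul_le_mul_left h2 hd0
  -- many pairs of vertices of a large set can be joined
  have hmany : ∀ S ∈ U, n ^ 2 ≤ 100 * (P.filter fun p => p.1 ∈ S ∧ p.2 ∈ S).card := by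
    intro S hS
    have hS4 : n ≤ 4 * S.card := (Finset.mem_filter.1 hS).2.1
    set S' := S \ full with hS'
    have hS'card : n ≤ 8 * S'.card := by
      have : S.card - full.card ≤ S'.card := Finset.le_card_sdiff full S
      omega
    have hsub : S' ×ˢ S' ⊆ (P.filter fun p => p.1 ∈ S ∧ p.2 ∈ S) ∪
        Finset.univ.biUnion fun a => (G.openBall g a).image fun b => (a, b) := by
      rintro ⟨a, b⟩ hab
      simp only [hS', hfull, Finset.mem_product, Finset.mem_sdiff, Finset.mem_filter,
        Finset.mem_univ, true_and] at hab
      by_cases hball : b ∈ G.openBall g a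
      · exact Finset.mem_union_right _ (Finset.mem_biUnion.2
          ⟨a, Finset.mem_univ _, Finset.mem_image.2 ⟨b, hball, rfl⟩⟩)
      · refine Finset.mem_union_left _ (Finset.mem_filter.2 ⟨?_, hab.1.1, hab.2.1⟩)
        exact Finset.mem_filter.2 ⟨Finset.mem_univ _, hab.1.2, hab.2.2, hball⟩
    have hclose : (Finset.univ.biUnion fun a => (G.openBall g a).image fun b => (a, b)).card ≤
        n * (d + 1) ^ g :=
      Finset.card_biUnion_le_card_mul _ _ _ fun a _ =>
        Finset.card_image_le.trans (card_openBall_le hd g a)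
    have h1 := (Finset.card_le_card hsub).trans (Finset.card_union_le _ _)
    rw [Finset.card_product] at h1
    nlinarith [Nat.mul_le_mul hS'card hS'card, Nat.mul_le_mul_left n hV]
  by_cases hU0 : U = ∅
  · exact ⟨G, hG, hd, by omega, by rw [← hU, hU0]; simp⟩
  -- a pair that is contained in many large independent sets
  obtain ⟨⟨a, b⟩, hab, hkill⟩ : ∃ p ∈ P, U.card ≤
      100 * (U.filter fun S => p.1 ∈ S ∧ p.2 ∈ S).card := by
    by_contra! hcon
    have hcount : ∑ p ∈ P, (U.filter fun S => p.1 ∈ S ∧ p.2 ∈ S).card =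
        ∑ S ∈ U, (P.filter fun p => p.1 ∈ S ∧ p.2 ∈ S).card :=
      Finset.sum_card_bipartiteAbove_eq_sum_card_bipartiteBelow _
    have h1 : U.card * n ^ 2 ≤ ∑ p ∈ P, 100 * (U.filter fun S => p.1 ∈ S ∧ p.2 ∈ S).card := by
      rw [← Finset.mul_sum, hcount, Finset.mul_sum, ← smul_eq_mul]
      exact Finset.card_nsmul_le_sum _ _ _ hmany
    have hUpos : 0 < U.card := Finset.card_pos.2 (Finset.nonempty_of_ne_empty hU0)
    have hPne : P.Nonempty := by
      rw [Finset.nonempty_iff_ne_empty]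
      intro hP0
      rw [hP0, Finset.sum_empty] at h1
      have : 0 < U.card * n ^ 2 := by positivity
      omega
    have h2 := Finset.sum_lt_sum_of_nonempty hPne hcon
    rw [Finset.sum_const, smul_eq_mul] at h2
    have h3 : P.card ≤ n ^ 2 := by
      refine (Finset.card_le_univ _).trans ?_
      rw [Fintype.card_prod, sq]
    have h4 := Nat.mul_le_mul_right U.card h3
    rw [mul_comm (n ^ 2)] at h4
    omega
  obtain ⟨-, ha, hb, hfar⟩ := Finset.mem_filter.1 hab
  dsimp only at ha hb
  have hfar' : ∀ w : G.Walk a b, g ≤ w.length := by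
    intro w
    by_contra! hlt
    exact hfar (Finset.mem_filter.2 ⟨Finset.mem_univ _, w, hlt⟩)
  have hne : a ≠ b := by
    rintro rfl
    have := hfar' .nil
    simp at this
    omega
  obtain ⟨H, hH⟩ : ∃ H, H = G ⊔ edge a b := ⟨_, rfl⟩
  have hdeg := degree_le_of_le_sup_edge hH.le
  refine ⟨H, hH ▸ hG.sup_edge hfar', fun v => ?_, ?_, ?_⟩
  · have h1 := hdeg v
    have h2 := hd v
    by_cases hva : v = a
    · subst hva
      rw [if_pos rfl, if_neg hne] at h1
      omega
    by_cases hvb : v = b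
    · subst hvb
      rw [if_neg hva, if_pos rfl] at h1
      omega
    · rw [if_neg hva, if_neg hvb] at h1
      omega
  · refine (Finset.sum_le_sum fun v _ => hdeg v).trans ?_
    rw [Finset.sum_add_distrib, Finset.sum_add_distrib]
    simp
  · have hle : G ≤ H := hH ▸ le_sup_left
    have hab' : H.Adj a b := by simp [hH, edge_adj, hne]
    have hsub : H.largeIndepSets ⊆ U \ (U.filter fun S => a ∈ S ∧ b ∈ S) := by
      intro S hS
      obtain ⟨-, hS4, hS⟩ := Finset.mem_filter.1 hS
      refine Finset.mem_sdiff.2 ⟨Finset.mem_filter.2 ⟨Finset.mem_univ _, hS4,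
        fun x hx y hy h => hS x hx y hy (hle h)⟩, fun h => ?_⟩
      obtain ⟨-, haS, hbS⟩ := Finset.mem_filter.1 h
      exact hS a haS b hbS hab'
    have h1 := Finset.card_le_card hsub
    have h2 := Finset.card_sdiff_add_card_eq_card (Finset.filter_subset
      (fun S => a ∈ S ∧ b ∈ S) U)
    dsimp only at hkill
    omega

/-- There are connected graphs whose girth is at least logarithmic in the number of vertices and
in which every set of at least a quarter of the vertices spans an edge. -/
theorem exists_noShortDetour_of_card (V : Type*) [Fintype V] [Nonempty V] {g : ℕ} (hg : 1 ≤ g)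
    (hV : 200 * 1121 ^ g ≤ Fintype.card V) :
    ∃ G : SimpleGraph V, G.NoShortDetour g ∧ G.Connected ∧
      ∀ S : Finset V, Fintype.card V ≤ 4 * S.card → ∃ a ∈ S, ∃ b ∈ S, G.Adj a b := by
  set n := Fintype.card V with hn
  have hn0 : 0 < n := Fintype.card_pos
  -- `70` new edges per vertex suffice, since `2 * 99 ^ 70 < 100 ^ 70`
  have hgreedy : ∀ j ≤ 70 * n, ∃ G : SimpleGraph V, G.NoShortDetour g ∧ (∀ v, G.degree v ≤ 1120) ∧
      ∑ v, G.degree v ≤ 2 * j ∧ 100 ^ j * G.largeIndepSets.card ≤ 99 ^ j * 2 ^ n := by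
    intro j hj
    induction j with
    | zero =>
      refine ⟨⊥, fun x y h => absurd h (by simp), by simp, by simp, ?_⟩
      rw [pow_zero, pow_zero, one_mul, one_mul]
      refine (Finset.card_le_univ _).trans ?_
      rw [Fintype.card_finset]
    | succ j ih =>
      obtain ⟨G, h1, h2, h3, h4⟩ := ih (by omega)
      obtain ⟨G', h1', h2', h3', h4'⟩ := exists_sup_edge hg h1 h2 (by omega) (by norm_num) hV
      refine ⟨G', h1', h2', by omega, ?_⟩
      calc 100 ^ (j + 1) * G'.largeIndepSets.card
          = 100 ^ j * (100 * G'.largeIndepSets.card) := by ring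
        _ ≤ 100 ^ j * (99 * G.largeIndepSets.card) := Nat.mul_le_mul_left _ h4'
        _ = 99 * (100 ^ j * G.largeIndepSets.card) := by ring
        _ ≤ 99 * (99 ^ j * 2 ^ n) := Nat.mul_le_mul_left _ h4
        _ = 99 ^ (j + 1) * 2 ^ n := by ring
  obtain ⟨G, h1, -, -, h4⟩ := hgreedy (70 * n) le_rfl
  have hempty : G.largeIndepSets = ∅ := by
    rw [← Finset.card_eq_zero]
    by_contra h
    have h5 : 100 ^ (70 * n) ≤ 99 ^ (70 * n) * 2 ^ n :=
      (Nat.le_mul_of_pos_right _ (Nat.pos_of_ne_zero h)).trans h4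
    rw [pow_mul, pow_mul, ← mul_pow] at h5
    exact absurd h5 (not_le.2 (Nat.pow_lt_pow_left (by norm_num) hn0.ne'))
  obtain ⟨G', hle, hG', hconn⟩ := h1.exists_connected
  refine ⟨G', hG', hconn, fun S hS => ?_⟩
  by_contra! hcon
  have : S ∈ G.largeIndepSets := Finset.mem_filter.2 ⟨Finset.mem_univ _, hS,
    fun a ha b hb h => hcon a ha b hb (hle h)⟩
  simp [hempty] at this

end

end

section

/-! ### Graphs without short cycles look like trees -/

variable {V : Type*} {G : SimpleGraph V}

lemma Connected.dist_lt_of_mem_support (hG : G.Connected) {u z x : V} {p : G.Walk u z}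
    (hp : p.length = G.dist u z) (hx : x ∈ p.support) (hne : x ≠ z) :
    G.dist u x < G.dist u z := by
  classical
  have h1 := dist_le (p.takeUntil x hx)
  have h2 := dist_le (p.dropUntil x hx)
  have h3 := hG.pos_dist_of_ne hne
  have h4 := congrArg Walk.length (p.take_spec hx)
  rw [Walk.length_append] at h4
  omega

/-- A shortest walk to `z` does not use an edge from `z` to a vertex that is not closer. -/
lemma Connected.notMem_edges (hG : G.Connected) {u z w : V} {p : G.Walk u z}
    (hp : p.length = G.dist u z) (hzw : z ≠ w) (h : G.dist u z ≤ G.dist u w) :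
    s(z, w) ∉ p.edges := fun hmem =>
  absurd (hG.dist_lt_of_mem_support hp (p.snd_mem_support_of_mem_edges hmem) hzw.symm) (by omega)

lemma Connected.exists_parent (hG : G.Connected) {u z : V} (hz : z ≠ u) :
    ∃ y, G.Adj z y ∧ G.dist u z = G.dist u y + 1 := by
  obtain ⟨p, hp⟩ := hG.exists_walk_length_eq_dist z u
  rcases p with _ | ⟨h, p⟩
  · exact absurd rfl hz
  rename_i y
  refine ⟨y, h, ?_⟩
  rw [Walk.length_cons] at hp
  have h1 := dist_le p
  have h2 : G.dist u z ≤ G.dist u y + G.dist y z := hG.dist_triangle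
  rw [dist_eq_one_iff_adj.2 h.symm] at h2
  rw [dist_comm] at hp h1
  omega

/-- A breadth-first search tree that contains all edges near its root. -/
lemma NoShortDetour.exists_isTree_le [Finite V] {g t : ℕ} (hG : G.NoShortDetour g)
    (hconn : G.Connected) (hg : 2 * t + 3 ≤ g) (u : V) :
    ∃ T ≤ G, T.IsTree ∧
      ∀ x y, G.Adj x y → G.dist u x ≤ t + 1 → G.dist u y ≤ t + 1 → T.Adj x y := by
  classical
  have hpar : ∀ z, ∃ y, z ≠ u → G.Adj z y ∧ G.dist u z = G.dist u y + 1 := by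
    intro z
    by_cases hz : z = u
    · exact ⟨u, fun h => absurd hz h⟩
    · obtain ⟨y, hy⟩ := hconn.exists_parent hz
      exact ⟨y, fun _ => hy⟩
  choose par hpar using hpar
  set T : SimpleGraph V := fromEdgeSet ((fun z => s(z, par z)) '' {u}ᶜ) with hT
  have hTpar : ∀ z, z ≠ u → T.Adj z (par z) := by
    intro z hz
    rw [hT, fromEdgeSet_adj]
    exact ⟨⟨z, hz, rfl⟩, (hpar z hz).1.ne⟩
  have hTle : T ≤ G := by
    intro x y hxy
    rw [hT, fromEdgeSet_adj] at hxy
    obtain ⟨⟨z, hz, h⟩, -⟩ := hxy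
    rw [← mem_edgeSet, ← h]
    exact (hpar z hz).1
  have hTconn : T.Connected := by
    have hreach : ∀ m z, G.dist u z = m → T.Reachable z u := by
      intro m
      induction m with
      | zero =>
        intro z hz
        rw [hconn.dist_eq_zero_iff.1 hz]
      | succ m ih =>
        intro z hz
        have hzu : z ≠ u := by
          rintro rfl
          simp at hz
        have := (hpar z hzu).2
        exact (hTpar z hzu).reachable.trans (ih _ (by omega))
    have : Nonempty V := ⟨u⟩
    exact ⟨fun x y => (hreach _ x rfl).trans (hreach _ y rfl).symm⟩
  have hTtree : T.IsTree := by
    rw [isTree_iff_connected_and_card]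
    refine ⟨hTconn, le_antisymm ?_ hTconn.card_vert_le_card_edgeSet_add_one⟩
    have h1 : T.edgeSet ⊆ (fun z => s(z, par z)) '' {u}ᶜ := by
      rw [hT, edgeSet_fromEdgeSet]
      exact Set.sdiff_subset
    have h2 : T.edgeSet.ncard ≤ ({u}ᶜ : Set V).ncard :=
      (Set.ncard_le_ncard h1).trans (Set.ncard_image_le (Set.toFinite _))
    have h3 := Set.ncard_add_ncard_compl ({u} : Set V)
    rw [Set.ncard_singleton] at h3
    change T.edgeSet.ncard + 1 ≤ _
    omega
  refine ⟨T, hTle, hTtree, ?_⟩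
  -- an edge that is missing in `T` would close a short cycle
  have key : ∀ x y, G.Adj x y → G.dist u x ≤ t + 1 → G.dist u y ≤ t + 1 →
      G.dist u x ≤ G.dist u y → T.Adj x y := by
    intro x y hxy hx hy hle
    obtain ⟨p, hp⟩ := hconn.exists_walk_length_eq_dist u x
    have hpe := hconn.notMem_edges hp hxy.ne hle
    rcases hle.eq_or_lt with heq | hlt
    · obtain ⟨r, hr⟩ := hconn.exists_walk_length_eq_dist u y
      have hre := hconn.notMem_edges hr hxy.ne.symm heq.ge
      have := hG hxy (p.reverse.append r) (by
        rw [Walk.edges_append, Walk.edges_reverse, List.mem_append, List.mem_reverse, not_or]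
        exact ⟨hpe, by rwa [Sym2.eq_swap]⟩)
      rw [Walk.length_append, Walk.length_reverse] at this
      omega
    · have hyu : y ≠ u := by
        rintro rfl
        simp at hlt
      obtain ⟨hadj, hdist⟩ := hpar y hyu
      by_cases hpx : par y = x
      · exact hpx ▸ (hTpar y hyu).symm
      obtain ⟨r, hr⟩ := hconn.exists_walk_length_eq_dist u (par y)
      have hre : s(x, y) ∉ r.edges := fun hmem => by
        have := hconn.dist_lt_of_mem_support hr (r.snd_mem_support_of_mem_edges hmem) hadj.ne
        omega
      have := hG hxy ((p.reverse.append r).append (.cons hadj.symm .nil)) (by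
        simp only [Walk.edges_append, Walk.edges_reverse, Walk.edges_cons, Walk.edges_nil,
          List.mem_append, List.mem_reverse, List.mem_singleton, not_or]
        refine ⟨⟨hpe, hre⟩, fun h => ?_⟩
        rw [Sym2.eq_iff] at h
        rcases h with ⟨h, -⟩ | ⟨-, h⟩
        · exact hpx h.symm
        · exact hadj.ne h)
      have hxyd : G.dist u y ≤ G.dist u x + 1 := by
        have h2 : G.dist u y ≤ G.dist u x + G.dist x y := hconn.dist_triangle
        rwa [dist_eq_one_iff_adj.2 hxy] at h2
      simp only [Walk.length_append, Walk.length_reverse, Walk.length_cons,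
        Walk.length_nil] at this
      omega
  intro x y hxy hx hy
  rcases le_total (G.dist u x) (G.dist u y) with h | h
  · exact key x y hxy hx hy h
  · exact (key y x hxy.symm hy hx h).symm

/-- A spanning subgraph that contains all edges inside a ball has the same view from its
centre. -/
lemma localView_eq_of_le {T : SimpleGraph V} (hle : T ≤ G) (ident : V → ℕ) {t : ℕ} {v : V}
    (hT : ∀ x y, G.Adj x y → G.edist v x ≤ t → G.edist v y ≤ t → T.Adj x y) :
    T.localView ident t v = G.localView ident t v := by
  classical
  have hball : ∀ w, T.edist v w ≤ t ↔ G.edist v w ≤ t := by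
    refine fun w => ⟨(edist_anti hle).trans, fun h => ?_⟩
    obtain ⟨p, hp⟩ := exists_walk_of_edist_ne_top (ne_top_of_le_ne_top (ENat.natCast_ne_top t) h)
    have hsupp : ∀ x ∈ p.support, G.edist v x ≤ t := by
      intro x hx
      refine (edist_le (p.takeUntil x hx)).trans (le_trans ?_ (hp.le.trans h))
      exact_mod_cast p.length_takeUntil_le_length hx
    have hedge : ∀ e ∈ p.edges, e ∈ T.edgeSet := by
      intro e he
      induction e with | _ x y =>
      exact hT x y (p.edges_subset_edgeSet he) (hsupp x (p.fst_mem_support_of_mem_edges he))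
        (hsupp y (p.snd_mem_support_of_mem_edges he))
    refine (edist_le (p.transfer T hedge)).trans ?_
    rw [Walk.length_transfer, hp]
    exact h
  simp only [localView, hball, LocalView.mk.injEq, true_and]
  funext a b
  refine propext (exists_congr fun x => exists_congr fun y => and_congr_right fun hx =>
    and_congr_right fun hy => and_congr_left fun _ => ⟨fun h => hle h, fun h => hT x y h hx hy⟩)

/-- An algorithm that colors trees also colors every connected graph whose cycles are all too long
for it to see. -/
lemma NoShortDetour.isPQColoring_run {n p q : ℕ} {c : ℝ} {A : LocalAlgorithm (Finset (Fin p))}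
    (hA : A.ColorsTrees q c n) {G : SimpleGraph (Fin n)} {g : ℕ} (hG : G.NoShortDetour g)
    (hconn : G.Connected) (hg : 2 * A.rounds n + 3 ≤ g) {ident : Fin n → ℕ}
    (hid : IsIdentifierAssignment c ident) : G.IsPQColoring p q (A.run G ident) := by
  have key : ∀ u, ∃ T : SimpleGraph (Fin n), T.IsPQColoring p q (A.run T ident) ∧
      (∀ v, G.Adj u v → T.Adj u v) ∧
      (∀ v, G.dist u v ≤ 1 → A.run T ident v = A.run G ident v) := by
    intro u
    obtain ⟨T, hle, hT, hedges⟩ := hG.exists_isTree_le hconn hg u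
    refine ⟨T, hA T ident hT hid, fun v huv => hedges u v huv (by simp) ?_, fun v huv => ?_⟩
    · rw [dist_eq_one_iff_adj.2 huv]
      omega
    · refine congrArg (A.output n) (localView_eq_of_le hle ident fun x y hxy hx hy => ?_)
      have hd : ∀ x, G.edist v x ≤ A.rounds n → G.dist u x ≤ A.rounds n + 1 := by
        intro x hx
        rw [← (hconn v x).coe_dist_eq_edist] at hx
        have h1 : G.dist v x ≤ A.rounds n := by exact_mod_cast hx
        have h2 : G.dist u x ≤ G.dist u v + G.dist v x := hconn.dist_triangle
        omega
      exact hedges x y hxy (hd x hx) (hd y hy)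
  refine ⟨fun v => ?_, fun u v huv => ?_⟩
  · obtain ⟨T, hT, -, hrun⟩ := key v
    rw [← hrun v (by simp)]
    exact hT.1 v
  · obtain ⟨T, hT, hadj, hrun⟩ := key u
    rw [← hrun u (by simp), ← hrun v (dist_eq_one_iff_adj.2 huv).le]
    exact hT.2 (hadj v huv)

/-- One of the colors of a `(2 * q + 1 : q)`-coloring is used by a third of the vertices. -/
lemma IsPQColoring.exists_large_indepSet {n q : ℕ} (hq : 1 ≤ q) (hn : 1 ≤ n)
    {G : SimpleGraph (Fin n)} {f : Fin n → Finset (Fin (2 * q + 1))}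
    (hf : G.IsPQColoring (2 * q + 1) q f) :
    ∃ S : Finset (Fin n), n ≤ 4 * S.card ∧ ∀ a ∈ S, ∀ b ∈ S, ¬ G.Adj a b := by
  have hcount : ∑ i, (Finset.univ.filter fun v => i ∈ f v).card = n * q := by
    have h := Finset.sum_card_bipartiteAbove_eq_sum_card_bipartiteBelow
      (s := (Finset.univ : Finset (Fin n))) (t := (Finset.univ : Finset (Fin (2 * q + 1))))
      (fun v i => i ∈ f v)
    simp only [Finset.bipartiteAbove, Finset.bipartiteBelow, Finset.filter_univ_mem, hf.1] at h
    rw [← h]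
    simp
  obtain ⟨i, hi⟩ : ∃ i, n ≤ 4 * (Finset.univ.filter fun v => i ∈ f v).card := by
    by_contra! hcon
    have h : ∑ i, 4 * (Finset.univ.filter fun v => i ∈ f v).card < ∑ _i : Fin (2 * q + 1), n :=
      Finset.sum_lt_sum_of_nonempty Finset.univ_nonempty fun i _ => hcon i
    rw [← Finset.mul_sum, hcount, Finset.sum_const, Finset.card_univ, Fintype.card_fin,
      smul_eq_mul] at h
    nlinarith
  refine ⟨_, hi, fun a ha b hb hab => ?_⟩
  exact Finset.disjoint_left.1 (hf.2 hab) (Finset.mem_filter.1 ha).2 (Finset.mem_filter.1 hb).2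

/-- The threshold for `n` absorbs the constants in `200 * 1121 ^ (2 * t + 3) ≤ n`, which the numbers
`t < log n / 32` of rounds satisfy. -/
theorem log_le_rounds {q : ℕ} (hq : 1 ≤ q) {c : ℝ} (hc : 1 ≤ c)
    (A : LocalAlgorithm (Finset (Fin (2 * q + 1)))) {n : ℕ} (hn : ⌈Real.exp 60⌉₊ ≤ n)
    (hA : A.ColorsTrees q c n) : 1 / 32 * Real.log n ≤ A.rounds n := by
  by_contra! hlt
  have hexp : Real.exp 60 ≤ n := (Nat.le_ceil _).trans (by exact_mod_cast hn)
  have hnpos : (0 : ℝ) < n := (Real.exp_pos _).trans_le hexp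
  have hn1 : 1 ≤ n := by exact_mod_cast hnpos
  have hlog : 60 ≤ Real.log n := (Real.le_log_iff_exp_le hnpos).2 hexp
  have hcard : 200 * 1121 ^ (2 * A.rounds n + 3) ≤ n := by
    have he : (2.7 : ℝ) ≤ Real.exp 1 := by linarith [Real.exp_one_gt_d9]
    have h200 : (200 : ℝ) ≤ Real.exp 6 := by
      calc (200 : ℝ) ≤ 2.7 ^ 6 := by norm_num
        _ ≤ Real.exp 1 ^ 6 := pow_le_pow_left₀ (by norm_num) he 6
        _ = Real.exp 6 := by rw [← Real.exp_nat_mul]; norm_num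
    have h1121 : (1121 : ℝ) ≤ Real.exp 8 := by
      calc (1121 : ℝ) ≤ 2.7 ^ 8 := by norm_num
        _ ≤ Real.exp 1 ^ 8 := pow_le_pow_left₀ (by norm_num) he 8
        _ = Real.exp 8 := by rw [← Real.exp_nat_mul]; norm_num
    have : (200 : ℝ) * 1121 ^ (2 * A.rounds n + 3) ≤ n := by
      calc (200 : ℝ) * 1121 ^ (2 * A.rounds n + 3)
          ≤ Real.exp 6 * Real.exp 8 ^ (2 * A.rounds n + 3) :=
            mul_le_mul h200 (pow_le_pow_left₀ (by norm_num) h1121 _) (by positivity)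
              (by positivity)
        _ = Real.exp (30 + 16 * A.rounds n) := by
            rw [← Real.exp_nat_mul, ← Real.exp_add]
            congr 1
            push_cast
            ring
        _ ≤ Real.exp (Real.log n) := Real.exp_le_exp.2 (by linarith)
        _ = n := Real.exp_log hnpos
    exact_mod_cast this
  have : Nonempty (Fin n) := ⟨⟨0, hn1⟩⟩
  obtain ⟨G, hG, hconn, hspan⟩ := exists_noShortDetour_of_card (Fin n)
    (g := 2 * A.rounds n + 3) (Nat.le_add_left 1 _) (by simpa using hcard)
  have hid : IsIdentifierAssignment c fun v : Fin n => (v : ℕ) + 1 := by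
    refine ⟨fun v w h => Fin.ext (Nat.succ.inj h), fun v => ⟨Nat.succ_pos _, ?_⟩⟩
    calc (((v : ℕ) + 1 : ℕ) : ℝ) ≤ n := by exact_mod_cast v.2
      _ = (n : ℝ) ^ (1 : ℝ) := (Real.rpow_one _).symm
      _ ≤ (n : ℝ) ^ c := Real.rpow_le_rpow_of_exponent_le (by exact_mod_cast hn1) hc
  obtain ⟨S, hS, hindep⟩ :=
    (hG.isPQColoring_run hA hconn le_rfl hid).exists_large_indepSet hq hn1
  obtain ⟨a, ha, b, hb, hab⟩ := hspan S (by simpa using hS)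
  exact hindep a ha b hb hab

end

end SimpleGraph

theorem mainTheorem6 :
    -- the upper bound
    (∀ c : ℝ, 1 ≤ c → ∃ C : ℝ, 0 < C ∧ ∀ q : ℕ, 1 ≤ q →
      ∃ A : LocalAlgorithm (Finset (Fin (2 * q + 1))), ∀ n : ℕ, 1 ≤ n →
        (A.rounds n : ℝ) ≤ C * (q * Real.log n + (q : ℝ) ^ 2) ∧ A.ColorsTrees q c n) ∧
    -- the lower bound
    (∀ q : ℕ, 1 ≤ q → ∃ δ : ℝ, 0 < δ ∧ ∃ N : ℕ, ∀ c : ℝ, 1 ≤ c →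
      ∀ (A : LocalAlgorithm (Finset (Fin (2 * q + 1)))) (n : ℕ), N ≤ n →
        A.ColorsTrees q c n → δ * Real.log n ≤ (A.rounds n : ℝ)) :=
  ⟨fun _ hc => SimpleGraph.exists_localAlgorithm hc,
    fun _ hq => ⟨1 / 32, by norm_num, ⌈Real.exp 60⌉₊, fun _ hc A _ hn hA => SimpleGraph.log_le_rounds hq hc A hn hA⟩⟩
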